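/- There is a nonempty Zariski open subset $U$ of the space of smooth plane cubic curves over $\mathbb{C}$ such that the following holds for every $C \in U$ and every flex $O \in C$. Let $E = (C, O)$ be the elliptic curve with underlying curve $C$ and neutral element $O$ (chord and tangent group law). For a point $P\in C$ write $t_P$ for the tangent line of $C$ at $P$; if $P$ is not a flex, its residual point is the remaining intersection point of $t_P$ with $C$. If $P$ is a point of order $9$ of $E$, $P'$ is the residual point of $P$ and $P''$ is the residual point of $P'$, then the lines $t_P, t_{P'}, t_{P''}$ form a *triangle* of $C$, said to be associated to the $3$-torsion point $[3]P$. For $T \in E[3]$ let $L_T = t_T$ be the inflectional tangent line at $T$. Then there exist generators $T_1, T_2$ of $E[3]$ and a triangle $\mathcal{L}_1$ associated to $T_1$ such that no three of the six lines consisting of $L_{T_1}$, $L_{[2]T_1}$, $L_{T_2}$ and the three lines of $\mathcal{L}_1$ are concurrent. -/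

import Mathlib

namespace PlaneCubic

/-- The complex projective plane. -/
abbrev Plane : Type := Projectivization ℂ (Fin 3 → ℂ)

/-- `F` is a form of degree three whose zero locus in the plane is smooth. -/
def IsSmoothCubic (F : MvPolynomial (Fin 3) ℂ) : Prop :=
  F.IsHomogeneous 3 ∧
    ∀ v : Fin 3 → ℂ, MvPolynomial.eval v F = 0 →
      (∀ i, MvPolynomial.eval v (MvPolynomial.pderiv i F) = 0) → v = 0

/-- The set of points of the curve `F = 0` in the plane. -/
def curve (F : MvPolynomial (Fin 3) ℂ) : Set Plane :=
  {P | MvPolynomial.eval P.rep F = 0}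

/-- The tangent line of the curve `F = 0` at `P`, as a set of points of the plane. -/
def tangentLine (F : MvPolynomial (Fin 3) ℂ) (P : Plane) : Set Plane :=
  {Q | ∑ i, MvPolynomial.eval P.rep (MvPolynomial.pderiv i F) * Q.rep i = 0}

/-- Some line of the plane cuts out the divisor `P + Q + R` on the cubic `F = 0`: with the line
parametrized by `(s, t) ↦ s • u + t • v`, the restriction of `F` to it is a nonzero multiple of
the product of the linear forms in `(s, t)` that vanish at `P`, at `Q` and at `R`. -/
def IsLineSection (F : MvPolynomial (Fin 3) ℂ) (P Q R : Plane) : Prop :=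
  ∃ u v : Fin 3 → ℂ, LinearIndependent ℂ ![u, v] ∧
    ∃ a b c : Fin 2 → ℂ,
      P.rep = a 0 • u + a 1 • v ∧ Q.rep = b 0 • u + b 1 • v ∧ R.rep = c 0 • u + c 1 • v ∧
      ∃ κ : ℂ, κ ≠ 0 ∧ ∀ s t : ℂ,
        MvPolynomial.eval (s • u + t • v) F =
          κ * (a 0 * t - a 1 * s) * (b 0 * t - b 1 * s) * (c 0 * t - c 1 * s)

/-- `O` is a flex (inflection point) of the cubic `F = 0`: some line meets the cubic at `O` with
multiplicity three. -/
def IsFlex (F : MvPolynomial (Fin 3) ℂ) (O : Plane) : Prop :=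
  IsLineSection F O O O

/-- The third intersection point with the cubic of the line through `P` and `Q` (of the tangent
line at `P` if `P = Q`). For points `P`, `Q` of a smooth cubic there is exactly one such point. -/
noncomputable def third (F : MvPolynomial (Fin 3) ℂ) (P Q : Plane) : Plane :=
  Classical.epsilon fun R => IsLineSection F P Q R

/-- The residual point of `P`: the remaining intersection point of the cubic with its tangent line
at `P`. -/
noncomputable def residual (F : MvPolynomial (Fin 3) ℂ) (P : Plane) : Plane :=
  third F P P

/-- The sum of `P` and `Q` in the elliptic curve `E = (C, O)`, by the chord and tangent rule. -/
noncomputable def add (F : MvPolynomial (Fin 3) ℂ) (O P Q : Plane) : Plane :=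
  third F O (third F P Q)

/-- The multiple `[n] P` in the elliptic curve `E = (C, O)`. -/
noncomputable def mul (F : MvPolynomial (Fin 3) ℂ) (O : Plane) : ℕ → Plane → Plane
  | 0, _ => O
  | n + 1, P => add F O (mul F O n P) P

/-- The `n`-torsion `E[n]` of the elliptic curve `E = (C, O)`. -/
def torsion (F : MvPolynomial (Fin 3) ℂ) (O : Plane) (n : ℕ) : Set Plane :=
  {P | P ∈ curve F ∧ mul F O n P = O}

/-- `T₁` and `T₂` generate `E[3]`, where `E = (C, O)`. -/
def GenerateThreeTorsion (F : MvPolynomial (Fin 3) ℂ) (O T₁ T₂ : Plane) : Prop :=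
  T₁ ∈ torsion F O 3 ∧ T₂ ∈ torsion F O 3 ∧
    ∀ T ∈ torsion F O 3, ∃ m n : ℕ, T = add F O (mul F O m T₁) (mul F O n T₂)

/-- `P` is a point of (exact) order `n` of the elliptic curve `E = (C, O)`. -/
def HasOrder (F : MvPolynomial (Fin 3) ℂ) (O P : Plane) (n : ℕ) : Prop :=
  P ∈ torsion F O n ∧ ∀ m : ℕ, 0 < m → m < n → P ∉ torsion F O m

/-- The lines `L 0`, `L 1`, `L 2` form a triangle associated to `T`: they are the tangent lines at
`P`, at the residual point `P'` of `P`, and at the residual point `P''` of `P'`, for some point `P`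
of order nine of `E = (C, O)` with `[3] P = T`. -/
def IsTriangleAssociatedTo (F : MvPolynomial (Fin 3) ℂ) (O T : Plane)
    (L : Fin 3 → Set Plane) : Prop :=
  ∃ P : Plane, HasOrder F O P 9 ∧ mul F O 3 P = T ∧
    L 0 = tangentLine F P ∧
    L 1 = tangentLine F (residual F P) ∧
    L 2 = tangentLine F (residual F (residual F P))

/-- No three (with distinct indices) of the lines of a family are concurrent. -/
def NoThreeConcurrent {ι : Type} (L : ι → Set Plane) : Prop :=
  ∀ i j k : ι, i ≠ j → i ≠ k → j ≠ k → L i ∩ L j ∩ L k = ∅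

/-- The ten exponents of the monomials of degree three in three variables. -/
abbrev CubicExponent : Type := {d : Fin 3 →₀ ℕ // d.degree = 3}

/-- The coefficients of a ternary cubic form. -/
noncomputable def coeffs (F : MvPolynomial (Fin 3) ℂ) : CubicExponent → ℂ :=
  fun d => F.coeff d.1

/-- The property `p` holds for a general smooth cubic: it holds for all smooth cubics that lie in
some nonempty Zariski open subset of the (irreducible) space of smooth cubics. The open subset is
taken to be the complement of a hypersurface `Φ = 0` in the space of coefficients; every nonempty
open subset contains a nonempty one of this form. -/
def HoldsForGeneralSmoothCubic (p : MvPolynomial (Fin 3) ℂ → Prop) : Prop :=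
  ∃ (n : ℕ) (Φ : MvPolynomial CubicExponent ℂ), Φ.IsHomogeneous n ∧
    (∃ F, IsSmoothCubic F ∧ MvPolynomial.eval (coeffs F) Φ ≠ 0) ∧
    ∀ F, IsSmoothCubic F → MvPolynomial.eval (coeffs F) Φ ≠ 0 → p F

end PlaneCubic

/-!
Every smooth plane cubic with a flex `O` becomes, in suitable coordinates, a Hesse cubic
`x³ + y³ + z³ = 3 l x y z` with `O = (1 : -1 : 0)` (`exists_hesse`). There the flexes are the
points with a vanishing coordinate, and translations by them are monomial substitutions. Let `ω` be
a primitive cube root of unity, `T₁ = (1 : -ω² : 0)` and `T₂ = (0 : 1 : -1)`. The condition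
`[3] P = T₁` says that the residual point of `P` is its translate `(x : ω y : ω² z)` by `-T₁`, and
it is solved by `x³ = l + m`, `y³ = l + ω m`, `z³ = l + ω² m`, `x y z = 1`, where `l³ + m³ = 1`.
In these coordinates the sides of the triangle are the lines with coefficients
`(y z : c x z : c² x y)` for the three cube roots of unity `c`.

Two sides of the triangle meet in a point of the curve other than a flex, and a flex tangent meets
the curve only in its flex, so no three lines among which are two sides of the triangle are
concurrent, the sides themselves being linearly independent. The remaining triples are excluded by
computation unless `l` is a root of one of finitely many polynomials in one variable
(`eq_zero_of_sixForms_eq_zero`, `exists_triangle_of_hesse`).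

A single exceptional value of `l` is harmless: the cubics equivalent to a fixed one are parametrized
by the nine entries of a matrix, while a cubic has ten coefficients, so these coefficients satisfy a
nontrivial homogeneous equation (`exists_hypersurface`). The product of these equations defines the
hypersurface to be avoided. It does not contain all smooth cubics, since these form a nonempty open
set in the classical topology (`exists_isSmoothCubic_eval_ne_zero`).

The group law is never established. The third point of a line section is unique on a smooth cubic
(`IsLineSection.unique`), so that sums and multiples are computed by exhibiting line sections.
-/

namespace PlaneCubic

open MvPolynomial

/-! ### Cubic forms and their polarization -/

theorem exists_eq_single_add_of_degree_eq_succ {d : Fin 3 →₀ ℕ} {n : ℕ} (hd : d.degree = n + 1) :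
    ∃ i d', d = Finsupp.single i 1 + d' ∧ d'.degree = n := by
  have hne : d ≠ 0 := by
    rintro rfl
    simp at hd
  obtain ⟨i, hi⟩ := Finsupp.ne_iff.1 hne
  have hle : Finsupp.single i 1 ≤ d := by
    rw [Finsupp.single_le_iff]
    exact Nat.one_le_iff_ne_zero.2 hi
  refine ⟨i, d - Finsupp.single i 1, (add_tsub_cancel_of_le hle).symm, ?_⟩
  have := congrArg Finsupp.degree (add_tsub_cancel_of_le hle)
  rw [map_add, Finsupp.degree_single, hd] at this
  omega

/-- Ternary cubic forms are spanned by the products of three variables. Identities that are linear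
in the form need only be verified on these. -/
theorem cubic_induction {p : MvPolynomial (Fin 3) ℂ → Prop}
    (zero : p 0) (add : ∀ F G, p F → p G → p (F + G)) (smul : ∀ (c : ℂ) F, p F → p (C c * F))
    (mono : ∀ i j k, p (X i * X j * X k))
    {F : MvPolynomial (Fin 3) ℂ} (hF : F.IsHomogeneous 3) : p F := by
  rw [F.as_sum]
  refine Finset.sum_induction _ p add zero fun d hd => ?_
  have hdeg : d.degree = 3 := by
    rw [Finsupp.degree_eq_weight_one]
    exact hF (mem_support_iff.1 hd)
  obtain ⟨i, d₁, rfl, h₁⟩ := exists_eq_single_add_of_degree_eq_succ hdeg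
  obtain ⟨j, d₂, rfl, h₂⟩ := exists_eq_single_add_of_degree_eq_succ h₁
  obtain ⟨k, d₃, rfl, h₃⟩ := exists_eq_single_add_of_degree_eq_succ h₂
  obtain rfl : d₃ = 0 := (Finsupp.degree_eq_zero_iff _).1 h₃
  have := smul (coeff (Finsupp.single i 1 + (Finsupp.single j 1 + (Finsupp.single k 1 + 0))) F) _
    (mono i j k)
  convert this using 1
  rw [X, X, X, monomial_mul, monomial_mul, C_mul_monomial, add_zero, add_assoc]
  simp

/-- The derivative of the form `F` at `v` in the direction `w`. -/
noncomputable def polar (F : MvPolynomial (Fin 3) ℂ) (v w : Fin 3 → ℂ) : ℂ :=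
  ∑ i, eval v (pderiv i F) * w i

theorem polar_add (F : MvPolynomial (Fin 3) ℂ) (v w w' : Fin 3 → ℂ) :
    polar F v (w + w') = polar F v w + polar F v w' := by
  simp [polar, mul_add, Finset.sum_add_distrib]

theorem polar_smul (F : MvPolynomial (Fin 3) ℂ) (v : Fin 3 → ℂ) (c : ℂ) (w : Fin 3 → ℂ) :
    polar F v (c • w) = c * polar F v w := by
  simp only [polar, Pi.smul_apply, smul_eq_mul, Finset.mul_sum]
  exact Finset.sum_congr rfl fun i _ => by ring

theorem polar_add_left (F G : MvPolynomial (Fin 3) ℂ) (v w : Fin 3 → ℂ) :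
    polar (F + G) v w = polar F v w + polar G v w := by
  simp [polar, add_mul, Finset.sum_add_distrib]

theorem polar_C_mul (F : MvPolynomial (Fin 3) ℂ) (c : ℂ) (v w : Fin 3 → ℂ) :
    polar (C c * F) v w = c * polar F v w := by
  simp [polar, Finset.mul_sum, mul_assoc]

theorem polar_mono (i j k : Fin 3) (v w : Fin 3 → ℂ) :
    polar (X i * X j * X k) v w = w i * v j * v k + v i * w j * v k + v i * v j * w k := by
  simp only [polar, Derivation.leibniz, pderiv_X, smul_eq_mul, map_add, map_mul, eval_X, add_mul,
    Finset.sum_add_distrib]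
  have h : ∀ (l : Fin 3) (c : Fin 3 → ℂ),
      ∑ x, c x * (eval v) (Pi.single (M := fun _ => MvPolynomial (Fin 3) ℂ) x 1 l) = c l := by
    intro l c
    rw [Finset.sum_eq_single l] <;> simp +contextual
  have h1 := h k fun x => v i * v j * w x
  have h2 := h j fun x => v k * v i * w x
  have h3 := h i fun x => v k * v j * w x
  simp only [mul_add, add_mul, Finset.sum_add_distrib]
  rw [show w i * v j * v k + v i * w j * v k + v i * v j * w k
    = v i * v j * w k + (v k * v i * w j + v k * v j * w i) by ring, ← h1, ← h2, ← h3]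
  congr 1
  · exact Finset.sum_congr rfl fun x _ => by ring
  · congr 1 <;> exact Finset.sum_congr rfl fun x _ => by ring

section

variable {F : MvPolynomial (Fin 3) ℂ}

theorem eval_smul_add_smul (hF : F.IsHomogeneous 3) (s t : ℂ) (u v : Fin 3 → ℂ) :
    eval (s • u + t • v) F
      = s ^ 3 * eval u F + s ^ 2 * t * polar F u v + s * t ^ 2 * polar F v u
        + t ^ 3 * eval v F := by
  refine cubic_induction (p := fun F => eval (s • u + t • v) F
      = s ^ 3 * eval u F + s ^ 2 * t * polar F u v + s * t ^ 2 * polar F v u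
        + t ^ 3 * eval v F) (by simp [polar]) ?_ ?_ ?_ hF
  · intro F G h1 h2
    simp only [map_add, polar_add_left, h1, h2]
    ring
  · intro c F h
    simp only [map_mul, eval_C, polar_C_mul, h]
    ring
  · intro i j k
    simp only [polar_mono, map_mul, eval_X, Pi.add_apply, Pi.smul_apply, smul_eq_mul]
    ring

theorem eval_smul_of_cubic (hF : F.IsHomogeneous 3) (s : ℂ) (u : Fin 3 → ℂ) :
    eval (s • u) F = s ^ 3 * eval u F := by
  have := eval_smul_add_smul hF s 0 u 0
  simpa using this

/-- The derivative of a cubic form along a line is a binary quadratic form. -/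
theorem polar_smul_add_smul (hF : F.IsHomogeneous 3) (s t : ℂ) (u v w : Fin 3 → ℂ) :
    polar F (s • u + t • v) w
      = s ^ 2 * polar F u w + s * t * (polar F (u + v) w - polar F u w - polar F v w)
        + t ^ 2 * polar F v w := by
  refine cubic_induction (p := fun F => polar F (s • u + t • v) w
      = s ^ 2 * polar F u w + s * t * (polar F (u + v) w - polar F u w - polar F v w)
        + t ^ 2 * polar F v w) (by simp [polar]) ?_ ?_ ?_ hF
  · intro F G h1 h2
    simp only [polar_add_left, h1, h2]
    ring
  · intro c F h
    simp only [polar_C_mul, h]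
    ring
  · intro i j k
    simp only [polar_mono, Pi.add_apply, Pi.smul_apply, smul_eq_mul]
    ring

theorem polar_smul_left (hF : F.IsHomogeneous 3) (s : ℂ) (u w : Fin 3 → ℂ) :
    polar F (s • u) w = s ^ 2 * polar F u w := by
  have := polar_smul_add_smul hF s 0 u 0 w
  simpa using this

/-- A cubic form in the coordinates of a triple of vectors. -/
theorem exists_eval_eq (hF : F.IsHomogeneous 3) (a b c : Fin 3 → ℂ) :
    ∃ m : ℂ, ∀ x y z : ℂ, eval (x • a + y • b + z • c) F
      = x ^ 3 * eval a F + y ^ 3 * eval b F + z ^ 3 * eval c F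
        + x ^ 2 * y * polar F a b + x ^ 2 * z * polar F a c + y ^ 2 * x * polar F b a
        + y ^ 2 * z * polar F b c + z ^ 2 * x * polar F c a + z ^ 2 * y * polar F c b
        + x * y * z * m := by
  refine ⟨polar F (a + b) c - polar F a c - polar F b c, fun x y z => ?_⟩
  have h := eval_smul_add_smul hF 1 z (x • a + y • b) c
  rw [one_smul, eval_smul_add_smul hF, polar_smul_add_smul hF, polar_add, polar_smul,
    polar_smul] at h
  rw [h]
  ring

/-- Euler's identity. -/
theorem polar_self (hF : F.IsHomogeneous 3) (v : Fin 3 → ℂ) : polar F v v = 3 * eval v F := by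
  have h := eval_smul_add_smul hF 1 1 v v
  rw [← add_smul, eval_smul_of_cubic hF] at h
  linear_combination (-1 / 2 : ℂ) * h

theorem IsSmoothCubic.eq_zero (hF : IsSmoothCubic F) {v : Fin 3 → ℂ}
    (h : ∀ w, polar F v w = 0) : v = 0 := by
  refine hF.2 v ?_ fun i => ?_
  · have := polar_self hF.1 v
    rw [h] at this
    simpa using this.symm
  · have := h (Pi.single i 1)
    simpa [polar, Pi.single_apply] using this

end

/-! ### Line sections -/

/-- The relation `IsLineSection` for vectors in place of points, and for an arbitrary function in
place of the cubic form, so that it can be transported along linear changes of coordinates. -/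
def LineSec (f : (Fin 3 → ℂ) → ℂ) (p q r : Fin 3 → ℂ) : Prop :=
  ∃ u v : Fin 3 → ℂ, LinearIndependent ℂ ![u, v] ∧
    ∃ a b c : Fin 2 → ℂ,
      p = a 0 • u + a 1 • v ∧ q = b 0 • u + b 1 • v ∧ r = c 0 • u + c 1 • v ∧
      ∃ κ : ℂ, κ ≠ 0 ∧ ∀ s t : ℂ,
        f (s • u + t • v) =
          κ * (a 0 * t - a 1 * s) * (b 0 * t - b 1 * s) * (c 0 * t - c 1 * s)

section

variable {f : (Fin 3 → ℂ) → ℂ} {p q r : Fin 3 → ℂ}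

theorem LineSec.swap_left (h : LineSec f p q r) : LineSec f q p r := by
  obtain ⟨u, v, huv, a, b, c, hp, hq, hr, κ, hκ, h⟩ := h
  exact ⟨u, v, huv, b, a, c, hq, hp, hr, κ, hκ, fun s t => by rw [h]; ring⟩

theorem LineSec.swap_right (h : LineSec f p q r) : LineSec f p r q := by
  obtain ⟨u, v, huv, a, b, c, hp, hq, hr, κ, hκ, h⟩ := h
  exact ⟨u, v, huv, a, c, b, hp, hr, hq, κ, hκ, fun s t => by rw [h]; ring⟩

theorem LineSec.smul (h : LineSec f p q r) {α β γ : ℂ} (hα : α ≠ 0) (hβ : β ≠ 0) (hγ : γ ≠ 0) :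
    LineSec f (α • p) (β • q) (γ • r) := by
  obtain ⟨u, v, huv, a, b, c, rfl, rfl, rfl, κ, hκ, h⟩ := h
  refine ⟨u, v, huv, α • a, β • b, γ • c, ?_, ?_, ?_, κ / (α * β * γ), by positivity, ?_⟩
  · simp [mul_smul]
  · simp [mul_smul]
  · simp [mul_smul]
  · intro s t
    rw [h]
    simp only [Pi.smul_apply, smul_eq_mul]
    field_simp

theorem LineSec.map (e : (Fin 3 → ℂ) ≃ₗ[ℂ] (Fin 3 → ℂ)) (h : LineSec (fun v => f (e v)) p q r) :
    LineSec f (e p) (e q) (e r) := by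
  obtain ⟨u, v, huv, a, b, c, rfl, rfl, rfl, κ, hκ, h⟩ := h
  refine ⟨e u, e v, ?_, a, b, c, by simp, by simp, by simp, κ, hκ, fun s t => ?_⟩
  · rw [LinearIndependent.pair_iff] at huv ⊢
    intro s t hst
    refine huv s t (e.injective ?_)
    simpa using hst
  · rw [← h]
    simp

theorem lineSec_chord (hpq : LinearIndependent ℂ ![p, q]) {κ α β : ℂ} (hκ : κ ≠ 0)
    (h : ∀ s t : ℂ, f (s • p + t • q) = κ * s * t * (α * t - β * s)) :
    LineSec f p q (α • p + β • q) :=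
  ⟨p, q, hpq, ![1, 0], ![0, 1], ![α, β], by simp, by simp, by simp, -κ, neg_ne_zero.2 hκ,
    fun s t => by
      rw [h]
      simp only [Matrix.cons_val_zero, Matrix.cons_val_one]
      ring⟩

theorem lineSec_tangent (hpq : LinearIndependent ℂ ![p, q]) {κ α β : ℂ} (hκ : κ ≠ 0)
    (h : ∀ s t : ℂ, f (s • p + t • q) = κ * t ^ 2 * (α * t - β * s)) :
    LineSec f p p (α • p + β • q) :=
  ⟨p, q, hpq, ![1, 0], ![1, 0], ![α, β], by simp, by simp, by simp, κ, hκ,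
    fun s t => by
      rw [h]
      simp only [Matrix.cons_val_zero, Matrix.cons_val_one]
      ring⟩

end

section

variable {F : MvPolynomial (Fin 3) ℂ} {p q r : Fin 3 → ℂ}

theorem LineSec.eval_eq_zero (h : LineSec (fun v => eval v F) p q r) : eval p F = 0 := by
  obtain ⟨u, v, -, a, b, c, rfl, -, -, κ, -, h⟩ := h
  simp only at h
  rw [h]
  ring

/-- The third point on a chord, in terms of the polarization. -/
theorem LineSec.exists_smul_eq_of_indep (hF : F.IsHomogeneous 3)
    (h : LineSec (fun v => eval v F) p q r) (hpq : LinearIndependent ℂ ![p, q]) :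
    ∃ κ : ℂ, κ ≠ 0 ∧ κ • r = polar F q p • p - polar F p q • q := by
  obtain ⟨u, v, huv, a, b, c, hp, hq, hr, κ, hκ, h⟩ := h
  have hδ : a 0 * b 1 - a 1 * b 0 ≠ 0 := by
    intro hδ
    have ha : a 1 = 0 ∧ a 0 = 0 := by
      have h1 : b 1 • p + (-a 1) • q = 0 := by
        rw [hp, hq]
        linear_combination (norm := module) hδ • u
      have h2 : (-b 0) • p + a 0 • q = 0 := by
        rw [hp, hq]
        linear_combination (norm := module) hδ • v
      have h1 := (LinearIndependent.pair_iff.1 hpq _ _ h1).2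
      have h2 := (LinearIndependent.pair_iff.1 hpq _ _ h2).2
      exact ⟨neg_eq_zero.1 h1, h2⟩
    have := (LinearIndependent.pair_iff.1 hpq 1 0 (by rw [hp, ha.1, ha.2]; simp)).1
    exact one_ne_zero this
  have key : ∀ s t : ℂ, s ^ 3 * eval p F + s ^ 2 * t * polar F p q + s * t ^ 2 * polar F q p
      + t ^ 3 * eval q F = -κ * s * t * (a 0 * b 1 - a 1 * b 0) ^ 2
        * (c 0 * (s * a 1 + t * b 1) - c 1 * (s * a 0 + t * b 0)) := by
    intro s t
    rw [← eval_smul_add_smul hF, hp, hq]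
    have := h (s * a 0 + t * b 0) (s * a 1 + t * b 1)
    simp only at this
    convert this using 1
    · congr 1
      congr 1
      module
    · ring
  have h1 := key 1 1
  have h2 := key 1 (-1)
  have h3 := key 1 0
  have h4 := key 0 1
  refine ⟨-κ * (a 0 * b 1 - a 1 * b 0) ^ 3, by simp [hκ, hδ], ?_⟩
  have e1 : polar F p q = -κ * (a 0 * b 1 - a 1 * b 0) ^ 2 * (c 0 * a 1 - c 1 * a 0) := by
    linear_combination (h1 - h2) / 2 - h4
  have e2 : polar F q p = -κ * (a 0 * b 1 - a 1 * b 0) ^ 2 * (c 0 * b 1 - c 1 * b 0) := by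
    linear_combination (h1 + h2) / 2 - h3
  rw [e1, e2, hp, hq, hr]
  module

/-- The remaining point on a tangent line, in terms of the polarization. -/
theorem LineSec.exists_smul_eq_of_tangent (hF : F.IsHomogeneous 3)
    (h : LineSec (fun v => eval v F) p p r) (hp0 : p ≠ 0) :
    ∃ w, LinearIndependent ℂ ![p, w] ∧ polar F p w = 0 ∧
      ∃ κ : ℂ, κ ≠ 0 ∧ κ • r = eval w F • p - polar F w p • w := by
  obtain ⟨u, v, huv, a, b, c, hp, hq, hr, κ, hκ, h⟩ := h
  obtain ⟨rfl⟩ : a = b := by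
    have h0 : (a 0 - b 0) • u + (a 1 - b 1) • v = 0 := by
      linear_combination (norm := module) hq - hp
    have := LinearIndependent.pair_iff.1 huv _ _ h0
    ext i
    fin_cases i
    · exact sub_eq_zero.1 this.1
    · exact sub_eq_zero.1 this.2
  obtain ⟨w0, w1, hw⟩ : ∃ w0 w1 : ℂ, a 0 * w1 - a 1 * w0 = 1 := by
    by_cases h0 : a 0 = 0
    · have h1 : a 1 ≠ 0 := by
        intro h1
        apply hp0
        rw [hp, h0, h1]
        simp
      exact ⟨-(a 1)⁻¹, 0, by simp [h1]⟩
    · exact ⟨0, (a 0)⁻¹, by simp [h0]⟩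
  have key : ∀ s t : ℂ, s ^ 3 * eval p F + s ^ 2 * t * polar F p (w0 • u + w1 • v)
      + s * t ^ 2 * polar F (w0 • u + w1 • v) p + t ^ 3 * eval (w0 • u + w1 • v) F
      = κ * t ^ 2 * (c 0 * (s * a 1 + t * w1) - c 1 * (s * a 0 + t * w0)) := by
    intro s t
    rw [← eval_smul_add_smul hF, hp]
    have := h (s * a 0 + t * w0) (s * a 1 + t * w1)
    simp only at this
    convert this using 1
    · congr 1
      congr 1
      module
    · linear_combination (-κ * t ^ 2 * (c 0 * (s * a 1 + t * w1) - c 1 * (s * a 0 + t * w0)))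
        * (a 0 * w1 - a 1 * w0 + 1) * hw
  have h1 := key 1 1
  have h2 := key 1 (-1)
  have h3 := key 1 0
  have h4 := key 0 1
  refine ⟨w0 • u + w1 • v, ?_, ?_, κ, hκ, ?_⟩
  · rw [LinearIndependent.pair_iff] at huv ⊢
    intro s t hst
    have := huv (s * a 0 + t * w0) (s * a 1 + t * w1) (by rw [hp] at hst; rw [← hst]; module)
    constructor
    · linear_combination w1 * this.1 - w0 * this.2 - s * hw
    · linear_combination a 0 * this.2 - a 1 * this.1 - t * hw
  · linear_combination (h1 - h2) / 2 - h4
  · have e1 : eval (w0 • u + w1 • v) F = κ * (c 0 * w1 - c 1 * w0) := by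
      linear_combination h4
    have e2 : polar F (w0 • u + w1 • v) p = κ * (c 0 * a 1 - c 1 * a 0) := by
      linear_combination (h1 + h2) / 2 - h3
    rw [e1, e2, hr, hp]
    have hw0 : (κ * c 0 * (1 - (a 0 * w1 - a 1 * w0))) = 0 := by rw [hw]; ring
    have hw1 : (κ * c 1 * (1 - (a 0 * w1 - a 1 * w0))) = 0 := by rw [hw]; ring
    linear_combination (norm := module) hw0 • u + hw1 • v

/-- The tangent line of a smooth cubic is spanned by any two of its points. -/
theorem IsSmoothCubic.exists_eq_of_polar_eq_zero (hF : IsSmoothCubic F) (hp : eval p F = 0)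
    {w w' : Fin 3 → ℂ} (hpw : LinearIndependent ℂ ![p, w]) (hw : polar F p w = 0)
    (hw' : polar F p w' = 0) : ∃ η θ : ℂ, w' = η • p + θ • w := by
  by_contra hcon
  have hli : LinearIndependent ℂ ![w', p, w] := by
    refine linearIndependent_finCons.2 ⟨hpw, fun hmem => hcon ?_⟩
    rw [Matrix.range_cons, Matrix.range_cons, Matrix.range_empty, Set.union_empty,
      Set.singleton_union, Submodule.mem_span_pair] at hmem
    obtain ⟨η, θ, h⟩ := hmem
    exact ⟨η, θ, h.symm⟩
  have htop := hli.span_eq_top_of_card_eq_finrank (by simp)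
  have hz : p = 0 := by
    refine hF.eq_zero fun x => ?_
    have hx : x ∈ Submodule.span ℂ (Set.range ![w', p, w]) := htop ▸ Submodule.mem_top
    induction hx using Submodule.span_induction with
    | mem x hx =>
      obtain ⟨i, rfl⟩ := hx
      fin_cases i
      · exact hw'
      · simpa [hp] using polar_self hF.1 p
      · exact hw
    | zero => simp [polar]
    | add x y _ _ hx hy => rw [polar_add, hx, hy, add_zero]
    | smul c x _ hx => rw [polar_smul, hx, mul_zero]
  have := LinearIndependent.pair_iff.1 hpw 1 0 (by simp [hz])
  exact one_ne_zero this.1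

/-- A smooth cubic contains no line. -/
theorem IsSmoothCubic.exists_eval_ne_zero (hF : IsSmoothCubic F) {u v : Fin 3 → ℂ}
    (huv : LinearIndependent ℂ ![u, v]) : ∃ s t : ℂ, eval (s • u + t • v) F ≠ 0 := by
  by_contra! hcon
  obtain ⟨n, hn⟩ : ∃ n, n ∉ Submodule.span ℂ (Set.range ![u, v]) := by
    by_contra! hall
    have h1 : Submodule.span ℂ (Set.range ![u, v]) = ⊤ := Submodule.eq_top_iff'.2 hall
    have h2 := finrank_span_eq_card huv
    rw [h1, finrank_top] at h2
    simp at h2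
  have hli : LinearIndependent ℂ ![n, u, v] := linearIndependent_finCons.2 ⟨huv, hn⟩
  have htop := hli.span_eq_top_of_card_eq_finrank (by simp)
  -- The derivative transversal to the line is a quadratic form on it, hence has a zero there.
  obtain ⟨s, t, hst, h0⟩ : ∃ s t : ℂ, (s, t) ≠ (0, 0) ∧ polar F (s • u + t • v) n = 0 := by
    by_cases hu : polar F u n = 0
    · exact ⟨1, 0, by simp, by simp [hu]⟩
    · obtain ⟨s, hs⟩ := exists_quadratic_eq_zero hu
        (b := polar F (u + v) n - polar F u n - polar F v n) (c := polar F v n)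
        (IsAlgClosed.exists_eq_mul_self _)
      refine ⟨s, 1, by simp, ?_⟩
      rw [polar_smul_add_smul hF.1]
      linear_combination hs
  have hline : ∀ a b : ℂ, polar F (s • u + t • v) (a • u + b • v) = 0 := by
    intro a b
    have key : ∀ τ : ℂ, eval ((1 : ℂ) • (s • u + t • v) + τ • (a • u + b • v)) F = 0 := by
      intro τ
      convert hcon (s + τ * a) (t + τ * b) using 3
      module
    have k1 := key 1
    have k2 := key (-1)
    rw [eval_smul_add_smul hF.1] at k1 k2
    have k3 := hcon a b
    linear_combination (k1 - k2) / 2 - k3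
  have hz : s • u + t • v = 0 := by
    refine hF.eq_zero fun x => ?_
    have hx : x ∈ Submodule.span ℂ (Set.range ![n, u, v]) := htop ▸ Submodule.mem_top
    induction hx using Submodule.span_induction with
    | mem x hx =>
      obtain ⟨i, rfl⟩ := hx
      fin_cases i
      · exact h0
      · simpa using hline 1 0
      · simpa using hline 0 1
    | zero => simp [polar]
    | add x y _ _ hx hy => rw [polar_add, hx, hy, add_zero]
    | smul c x _ hx => rw [polar_smul, hx, mul_zero]
  have := LinearIndependent.pair_iff.1 huv s t hz
  exact hst (by rw [this.1, this.2])

end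

/-! ### The third point of a line section -/

section

variable {F : MvPolynomial (Fin 3) ℂ} {p q r r' : Fin 3 → ℂ}

theorem exists_smul_eq_of_not_linearIndependent (hp : p ≠ 0) (hq : q ≠ 0)
    (h : ¬ LinearIndependent ℂ ![p, q]) : ∃ c : ℂ, c ≠ 0 ∧ q = c • p := by
  rw [LinearIndependent.pair_iff' hp] at h
  push Not at h
  obtain ⟨c, rfl⟩ := h
  exact ⟨c, fun hc => hq (by simp [hc]), rfl⟩

theorem LineSec.unique (hF : IsSmoothCubic F) (hp : p ≠ 0) (hq : q ≠ 0)
    (h : LineSec (fun v => eval v F) p q r) (h' : LineSec (fun v => eval v F) p q r') :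
    ∃ c : ℂ, c • r' = r := by
  by_cases hpq : LinearIndependent ℂ ![p, q]
  · obtain ⟨κ, hκ, e⟩ := h.exists_smul_eq_of_indep hF.1 hpq
    obtain ⟨κ', -, e'⟩ := h'.exists_smul_eq_of_indep hF.1 hpq
    refine ⟨κ⁻¹ * κ', ?_⟩
    rw [mul_smul, e', ← e, inv_smul_smul₀ hκ]
  · obtain ⟨c, hc, rfl⟩ := exists_smul_eq_of_not_linearIndependent hp hq hpq
    have hc' := inv_ne_zero hc
    have h := h.smul one_ne_zero hc' one_ne_zero
    have h' := h'.smul one_ne_zero hc' one_ne_zero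
    simp only [one_smul, inv_smul_smul₀ hc] at h h'
    obtain ⟨w, hw, hpw, κ, hκ, e⟩ := h.exists_smul_eq_of_tangent hF.1 hp
    obtain ⟨w', hw', hpw', κ', hκ', e'⟩ := h'.exists_smul_eq_of_tangent hF.1 hp
    have h0 : eval p F = 0 := h.eval_eq_zero
    obtain ⟨η, θ, rfl⟩ := hF.exists_eq_of_polar_eq_zero h0 hw' hpw' hpw
    have k1 := eval_smul_add_smul hF.1 η θ p w'
    have k2 := eval_smul_add_smul hF.1 1 1 p (η • p + θ • w')
    rw [one_smul, one_smul, show p + (η • p + θ • w') = (1 + η) • p + θ • w' by module,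
      eval_smul_add_smul hF.1, h0, hpw', hpw, k1, h0, hpw'] at k2
    have e2 : polar F (η • p + θ • w') p = θ ^ 2 * polar F w' p := by
      linear_combination -k2
    refine ⟨κ⁻¹ * (θ ^ 3 * κ'), ?_⟩
    have : κ • r = (θ ^ 3 * κ') • r' := by
      rw [e, mul_smul, e', e2, k1, h0, hpw']
      module
    rw [mul_smul, ← this, inv_smul_smul₀ hκ]

/-- On the tangent line at a flex of a smooth cubic the second polar vanishes as well. -/
theorem LineSec.polar_eq_zero_of_flex (hF : IsSmoothCubic F) (hp : p ≠ 0)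
    (h : LineSec (fun v => eval v F) p p p) {w' : Fin 3 → ℂ} (hw' : polar F p w' = 0) :
    polar F w' p = 0 := by
  obtain ⟨w, hw, hpw, κ, hκ, e⟩ := h.exists_smul_eq_of_tangent hF.1 hp
  have h0 : eval p F = 0 := h.eval_eq_zero
  have hwp : polar F w p = 0 := by
    have := (LinearIndependent.pair_iff.1 hw (eval w F - κ) (-polar F w p)
      (by rw [sub_smul, e]; module)).2
    exact neg_eq_zero.1 this
  obtain ⟨η, θ, rfl⟩ := hF.exists_eq_of_polar_eq_zero h0 hw hpw hw'
  have k1 := eval_smul_add_smul hF.1 η θ p w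
  have k2 := eval_smul_add_smul hF.1 1 1 p (η • p + θ • w)
  rw [one_smul, one_smul, show p + (η • p + θ • w) = (1 + η) • p + θ • w by module,
    eval_smul_add_smul hF.1, h0, hpw, hw', k1, h0, hpw, hwp] at k2
  linear_combination -k2

theorem exists_lineSec (hF : IsSmoothCubic F) (hp : p ≠ 0) (hq : q ≠ 0) (hp0 : eval p F = 0)
    (hq0 : eval q F = 0) : ∃ r, r ≠ 0 ∧ LineSec (fun v => eval v F) p q r := by
  by_cases hpq : LinearIndependent ℂ ![p, q]
  · have hsec := lineSec_chord (f := fun v => eval v F) (κ := 1) (α := polar F q p)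
      (β := -polar F p q) hpq one_ne_zero
      (fun s t => by rw [eval_smul_add_smul hF.1, hp0, hq0]; ring)
    refine ⟨_, fun h0 => ?_, hsec⟩
    have h0 := LinearIndependent.pair_iff.1 hpq _ _ h0
    obtain ⟨s, t, hst⟩ := hF.exists_eval_ne_zero hpq
    apply hst
    rw [eval_smul_add_smul hF.1, hp0, hq0, h0.1, neg_eq_zero.1 h0.2]
    ring
  · obtain ⟨c, hc, rfl⟩ := exists_smul_eq_of_not_linearIndependent hp hq hpq
    obtain ⟨w, hw, hpw⟩ : ∃ w, LinearIndependent ℂ ![p, w] ∧ polar F p w = 0 := by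
      -- The directions tangent at `p` form a space of dimension at least two.
      by_contra! hcon
      have hlin : ∀ w, polar F p w = 0 → ∃ a : ℂ, w = a • p := by
        intro w hw
        by_contra! h
        refine hcon w ((LinearIndependent.pair_iff' hp).2 fun a ha => h a ha.symm) hw
      let φ : (Fin 3 → ℂ) →ₗ[ℂ] ℂ :=
        { toFun := polar F p
          map_add' := polar_add F p
          map_smul' := fun c w => by simp [polar_smul] }
      have hker : LinearMap.ker φ ≤ Submodule.span ℂ {p} := by
        intro w hw
        obtain ⟨a, rfl⟩ := hlin w hw
        exact Submodule.smul_mem _ _ (Submodule.mem_span_singleton_self p)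
      have h1 := LinearMap.finrank_range_add_finrank_ker φ
      have h2 := Submodule.finrank_mono hker
      rw [finrank_span_singleton hp] at h2
      have h3 := Submodule.finrank_le (LinearMap.range φ)
      simp only [Module.finrank_self, Module.finrank_fin_fun] at h1 h3
      omega
    have hsec := lineSec_tangent (f := fun v => eval v F) (κ := 1) (α := eval w F)
      (β := -polar F w p) hw one_ne_zero
      (fun s t => by rw [eval_smul_add_smul hF.1, hp0, hpw]; ring)
    have hsec' := hsec.smul one_ne_zero hc one_ne_zero
    rw [one_smul, one_smul] at hsec'
    refine ⟨_, fun h0 => ?_, hsec'⟩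
    have h0 := LinearIndependent.pair_iff.1 hw _ _ h0
    obtain ⟨s, t, hst⟩ := hF.exists_eval_ne_zero hw
    apply hst
    rw [eval_smul_add_smul hF.1, hp0, hpw, h0.1, neg_eq_zero.1 h0.2]
    ring

end

/-! ### Chord and tangent operations -/

section

variable {F : MvPolynomial (Fin 3) ℂ} {O P Q R R' : Plane}

theorem isLineSection_iff :
    IsLineSection F P Q R ↔ LineSec (fun v => eval v F) P.rep Q.rep R.rep :=
  Iff.rfl

theorem isLineSection_mk {p q r : Fin 3 → ℂ} (hp : p ≠ 0) (hq : q ≠ 0) (hr : r ≠ 0)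
    (h : LineSec (fun v => eval v F) p q r) :
    IsLineSection F (.mk ℂ p hp) (.mk ℂ q hq) (.mk ℂ r hr) := by
  obtain ⟨a, ha⟩ := Projectivization.exists_smul_eq_mk_rep ℂ p hp
  obtain ⟨b, hb⟩ := Projectivization.exists_smul_eq_mk_rep ℂ q hq
  obtain ⟨c, hc⟩ := Projectivization.exists_smul_eq_mk_rep ℂ r hr
  rw [isLineSection_iff, ← ha, ← hb, ← hc]
  exact h.smul a.ne_zero b.ne_zero c.ne_zero

theorem IsLineSection.swap_left (h : IsLineSection F P Q R) : IsLineSection F Q P R :=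
  LineSec.swap_left (isLineSection_iff.1 h)

theorem IsLineSection.swap_right (h : IsLineSection F P Q R) : IsLineSection F P R Q :=
  LineSec.swap_right (isLineSection_iff.1 h)

theorem IsLineSection.unique (hF : IsSmoothCubic F) (h : IsLineSection F P Q R)
    (h' : IsLineSection F P Q R') : R = R' := by
  rw [← R.mk_rep, ← R'.mk_rep, Projectivization.mk_eq_mk_iff']
  exact LineSec.unique hF P.rep_nonzero Q.rep_nonzero h h'

theorem IsLineSection.third_eq (hF : IsSmoothCubic F) (h : IsLineSection F P Q R) :
    third F P Q = R :=
  IsLineSection.unique hF (Classical.epsilon_spec (p := fun R => IsLineSection F P Q R) ⟨R, h⟩) h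

theorem isLineSection_third (hF : IsSmoothCubic F) (hP : P ∈ curve F) (hQ : Q ∈ curve F) :
    IsLineSection F P Q (third F P Q) := by
  obtain ⟨r, hr, h⟩ := exists_lineSec hF P.rep_nonzero Q.rep_nonzero hP hQ
  have := isLineSection_mk P.rep_nonzero Q.rep_nonzero hr h
  rw [P.mk_rep, Q.mk_rep] at this
  exact Classical.epsilon_spec (p := fun R => IsLineSection F P Q R) ⟨_, this⟩

theorem IsLineSection.left_mem (h : IsLineSection F P Q R) : P ∈ curve F :=
  LineSec.eval_eq_zero h

theorem IsLineSection.right_mem (h : IsLineSection F P Q R) : R ∈ curve F :=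
  h.swap_right.swap_left.left_mem

theorem third_third (hF : IsSmoothCubic F) (hO : O ∈ curve F) (hP : P ∈ curve F) :
    third F O (third F O P) = P :=
  (isLineSection_third hF hO hP).swap_right.third_eq hF

theorem mul_one_eq (hF : IsSmoothCubic F) (hO : O ∈ curve F) (hP : P ∈ curve F) :
    mul F O 1 P = P :=
  third_third hF hO hP

/-- The multiples of a point, from a list of line sections that certifies them. -/
theorem mul_eq_of_isLineSection (hF : IsSmoothCubic F) (p q : ℕ → Plane) (h0 : p 0 = O)
    (hpq : ∀ n, IsLineSection F O (q n) (p n))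
    (hstep : ∀ n, IsLineSection F (p n) (p 1) (q (n + 1))) (n : ℕ) :
    mul F O n (p 1) = p n := by
  induction n with
  | zero => exact h0.symm
  | succ n ih =>
    rw [mul, ih, add, (hstep n).third_eq hF, (hpq (n + 1)).third_eq hF]

/-- If `T` is a flex, as `O` is, then `[2] T` lies on the line through `O` and `T`. -/
theorem mul_two_of_isFlex (hF : IsSmoothCubic F) (hO : O ∈ curve F) (hT : IsFlex F T) :
    mul F O 2 T = third F O T := by
  rw [mul, mul_one_eq hF hO hT.left_mem, add, hT.third_eq hF]

/-- The flexes of the curve are exactly the three-torsion points. -/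
theorem mem_torsion_three_iff (hF : IsSmoothCubic F) (hO : IsFlex F O) {T : Plane} :
    T ∈ torsion F O 3 ↔ IsFlex F T := by
  have hOc : O ∈ curve F := hO.left_mem
  constructor
  · rintro ⟨hT, h⟩
    have hTT := isLineSection_third hF hT hT
    have h2 := isLineSection_third hF hOc hTT.right_mem
    rw [mul, mul, mul_one_eq hF hOc hT, add, add] at h
    -- The line through `[2] T` and `T` meets the curve in `-[3] T = O`.
    have h3 := isLineSection_third hF h2.right_mem hT
    have h4 := isLineSection_third hF hOc h3.right_mem
    rw [h] at h4
    have h5 := (h4.swap_right).unique hF hO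
    rw [h5] at h3
    have h7 := h3.swap_right.swap_left.unique hF (h2.swap_right)
    have h8 : third F T T = T := h7.symm
    rw [h8] at hTT
    exact hTT
  · intro hT
    refine ⟨hT.left_mem, ?_⟩
    have h := isLineSection_third hF hOc hT.left_mem
    rw [mul, mul_two_of_isFlex hF hOc hT, add, h.swap_left.swap_right.swap_left.third_eq hF,
      hO.third_eq hF]

end

/-! ### The Hesse pencil -/

/-- The Hesse cubic `x³ + y³ + z³ - 3 l x y z`. -/
def hesse (l : ℂ) (v : Fin 3 → ℂ) : ℂ :=
  v 0 ^ 3 + v 1 ^ 3 + v 2 ^ 3 - 3 * l * v 0 * v 1 * v 2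

/-- The equation, in `w`, of the tangent line of the Hesse cubic at `v`. -/
def hesseTangent (l : ℂ) (v w : Fin 3 → ℂ) : ℂ :=
  (v 0 ^ 2 - l * v 1 * v 2) * w 0 + (v 1 ^ 2 - l * v 0 * v 2) * w 1
    + (v 2 ^ 2 - l * v 0 * v 1) * w 2

section

variable {l m ω ε : ℂ}

theorem cube_add_cube_add_cube {R : Type*} [CommRing R] {a b c : R} (h : a + b + c = 0) :
    a ^ 3 + b ^ 3 + c ^ 3 = 3 * a * b * c := by
  linear_combination (a ^ 2 + b ^ 2 + c ^ 2 - a * b - b * c - a * c) * h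

/-- The tangent line at the flex `(1 : -ε : 0)` meets the curve in no other point. -/
theorem flexTangent_ne_zero (hl : l ^ 3 ≠ 1) (hε : ε ^ 3 = 1) {x y z : ℂ}
    (h : x ^ 3 + y ^ 3 + z ^ 3 = 3 * l * x * y * z) (hz : z ≠ 0) :
    x + ε ^ 2 * y + l * ε * z ≠ 0 := by
  intro h0
  have h1 := cube_add_cube_add_cube h0
  have h2 : (l ^ 3 - 1) * z ^ 3 = 0 := by
    linear_combination h1 - h - (y ^ 3 * (ε ^ 3 + 1) + l ^ 3 * z ^ 3 - 3 * l * x * y * z) * hε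
  rcases mul_eq_zero.1 h2 with h | h
  · exact hl (sub_eq_zero.1 h)
  · exact hz (pow_eq_zero_iff (by norm_num) |>.1 h)

/-- The line through the flex `(1 : -ε : 0)` and another point of the Hesse cubic. -/
theorem lineSec_flex (hε : ε ^ 3 = 1) {x y z : ℂ}
    (h : x ^ 3 + y ^ 3 + z ^ 3 = 3 * l * x * y * z) (hne : x + ε ^ 2 * y + l * ε * z ≠ 0) :
    LineSec (hesse l) ![1, -ε, 0] ![x, y, z] ![ε * y, x, ε ^ 2 * z] := by
  have hε0 : ε ≠ 0 := by
    rintro rfl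
    norm_num at hε
  have hli : LinearIndependent ℂ ![![1, -ε, 0], ![x, y, z]] := by
    rw [LinearIndependent.pair_iff]
    intro s t hst
    have h0 := congrFun hst 0
    have h1 := congrFun hst 1
    have h2 := congrFun hst 2
    simp at h0 h1 h2
    have ht : t * (x + ε ^ 2 * y + l * ε * z) = 0 := by
      have h2' : t * z = 0 := by simpa using h2
      linear_combination h0 + ε ^ 2 * h1 + l * ε * h2' + s * hε
    have ht := (mul_eq_zero.1 ht).resolve_right hne
    refine ⟨?_, ht⟩
    rw [ht] at h0
    simpa using h0
  have := (lineSec_chord (f := hesse l) (κ := -3 * (x + ε ^ 2 * y + l * ε * z))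
    (α := ε ^ 2 * y - x) (β := 1) hli (by simpa using hne) (fun s t => ?_)).smul one_ne_zero
    one_ne_zero (pow_ne_zero 2 hε0)
  · convert this using 1
    · simp
    · simp
    · ext i
      fin_cases i
      · simp
        linear_combination -(ε * y) * hε
      · simp
        linear_combination (-x + ε ^ 2 * y) * hε
      · simp
  · simp [hesse]
    linear_combination t ^ 3 * h + (-s ^ 3 + 3 * s * t ^ 2 * (ε * y ^ 2 + l * y * z)) * hε

theorem lineSec_flex_self (hl : l ^ 3 ≠ 1) (hε : ε ^ 3 = 1) :
    LineSec (hesse l) ![1, -ε, 0] ![1, -ε, 0] ![1, -ε, 0] := by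
  have hli : LinearIndependent ℂ ![![1, -ε, 0], ![-(l * ε), 0, 1]] := by
    rw [LinearIndependent.pair_iff]
    intro s t hst
    have h0 := congrFun hst 0
    have h2 := congrFun hst 2
    simp at h0 h2
    subst h2
    simpa using h0
  have := lineSec_tangent (f := hesse l) (κ := 1 - l ^ 3)
    (α := 1) (β := 0) hli (sub_ne_zero.2 (Ne.symm hl)) (fun s t => ?_)
  · convert this using 1
    simp
  · simp [hesse]
    linear_combination (-s ^ 3 - t ^ 3 * l ^ 3) * hε

theorem lineSec_flex_self' (hl : l ^ 3 ≠ 1) :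
    LineSec (hesse l) ![0, 1, -1] ![0, 1, -1] ![0, 1, -1] := by
  have hli : LinearIndependent ℂ ![![0, 1, -1], ![1, -l, 0]] := by
    rw [LinearIndependent.pair_iff]
    intro s t hst
    have h0 := congrFun hst 0
    have h2 := congrFun hst 2
    simp at h0 h2
    exact ⟨h2, h0⟩
  have := lineSec_tangent (f := hesse l) (κ := 1 - l ^ 3)
    (α := 1) (β := 0) hli (sub_ne_zero.2 (Ne.symm hl)) (fun s t => ?_)
  · convert this using 1
    simp
  · simp [hesse]
    ring

/-- The tangent line at a point `P` with `[3] P = (1 : -ω² : 0)`: the residual point is the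
translate of `P` by `-[3] P`. -/
theorem lineSec_nine (hω : ω ^ 2 + ω + 1 = 0) (hm : m ≠ 0) {x y z : ℂ} (hx : x ^ 3 = l + m)
    (hy : y ^ 3 = l + ω * m) (hz : z ^ 3 = l + ω ^ 2 * m) (hxyz : x * y * z = 1) :
    LineSec (hesse l) ![x, y, z] ![x, y, z] ![x, ω * y, ω ^ 2 * z] := by
  have hω3 : ω ^ 3 = 1 := by linear_combination (ω - 1) * hω
  have hω1 : ω ≠ 1 := by
    rintro rfl
    norm_num at hω
  have hx0 : x ≠ 0 := by
    rintro rfl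
    simp at hxyz
  have hy0 : y ≠ 0 := by
    rintro rfl
    simp at hxyz
  have hli : LinearIndependent ℂ ![![x, y, z], ![x, ω * y, ω ^ 2 * z]] := by
    rw [LinearIndependent.pair_iff]
    intro s t hst
    have h0 := congrFun hst 0
    have h1 := congrFun hst 1
    simp at h0 h1
    have h0 : s + t = 0 := by
      refine (mul_eq_zero.1 (?_ : x * (s + t) = 0)).resolve_left hx0
      linear_combination h0
    have h1 : s + t * ω = 0 := by
      refine (mul_eq_zero.1 (?_ : y * (s + t * ω) = 0)).resolve_left hy0
      linear_combination h1
    have ht : t * (ω - 1) = 0 := by linear_combination h1 - h0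
    have ht := (mul_eq_zero.1 ht).resolve_right (sub_ne_zero.2 hω1)
    exact ⟨by linear_combination h0 - ht, ht⟩
  have := lineSec_tangent (f := hesse l) (κ := -9 * m)
    (α := 0) (β := 1) hli (by simpa using hm) (fun s t => ?_)
  · convert this using 1
    simp
  · have h1 : hesse l (s • ![x, y, z] + t • ![x, ω * y, ω ^ 2 * z])
        = x ^ 3 * (s + t) ^ 3 + y ^ 3 * (s + ω * t) ^ 3 + z ^ 3 * (s + ω ^ 2 * t) ^ 3
          - 3 * l * (x * y * z) * ((s + t) * (s + ω * t) * (s + ω ^ 2 * t)) := by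
      simp [hesse]
      ring
    rw [h1, hx, hy, hz, hxyz]
    linear_combination (l * (3 * s * t ^ 2 * (1 - 2 * ω + ω ^ 2)
      + t ^ 3 * (ω - 1) ^ 2 * (ω ^ 2 + ω + 1))
      + m * (s ^ 3 + 3 * s ^ 2 * t * (1 - ω + ω ^ 2) + 3 * s * t ^ 2 * (ω - 1) * (ω ^ 3 + 2)
        + t ^ 3 * (1 - ω + ω ^ 2) * (1 - ω ^ 2 + ω ^ 4))) * hω

end

/-! ### Points in Hesse coordinates -/

/-- The point of the plane with homogeneous coordinates `v` with respect to the frame `e`; if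
`v = 0`, an arbitrary point. -/
noncomputable def framePoint (e : (Fin 3 → ℂ) ≃ₗ[ℂ] (Fin 3 → ℂ)) (v : Fin 3 → ℂ) : Plane :=
  open Classical in
  if h : e v ≠ 0 then .mk ℂ (e v) h else .mk ℂ (fun _ => 1) (Function.ne_iff.2 ⟨0, one_ne_zero⟩)

section

variable {F : MvPolynomial (Fin 3) ℂ} {e : (Fin 3 → ℂ) ≃ₗ[ℂ] (Fin 3 → ℂ)} {l : ℂ}
  {u v w : Fin 3 → ℂ}

theorem framePoint_of_ne (h : e v ≠ 0) : framePoint e v = .mk ℂ (e v) h :=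
  dif_pos h

theorem framePoint_smul {c : ℂ} (hc : c ≠ 0) : framePoint e (c • v) = framePoint e v := by
  by_cases hv : e v = 0
  · have : e (c • v) = 0 := by simp [hv]
    rw [framePoint, framePoint, dif_neg (not_not.2 hv), dif_neg (not_not.2 this)]
  · have : e (c • v) ≠ 0 := by simpa [hc] using hv
    rw [framePoint_of_ne hv, framePoint_of_ne this, Projectivization.mk_eq_mk_iff']
    exact ⟨c, by simp⟩

theorem framePoint_of_eq_smul {c : ℂ} (hc : c ≠ 0) (h : v = c • w) :
    framePoint e v = framePoint e w := by
  rw [h, framePoint_smul hc]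

theorem exists_framePoint_eq (e : (Fin 3 → ℂ) ≃ₗ[ℂ] (Fin 3 → ℂ)) (P : Plane) :
    ∃ v, v ≠ 0 ∧ P = framePoint e v := by
  refine ⟨e.symm P.rep, by simpa using P.rep_nonzero, ?_⟩
  rw [framePoint_of_ne (by simpa using P.rep_nonzero)]
  simp

theorem exists_smul_eq_of_framePoint_eq (hv : v ≠ 0) (hw : w ≠ 0)
    (h : framePoint e v = framePoint e w) : ∃ c : ℂ, c • w = v := by
  rw [framePoint_of_ne (by simpa using hv), framePoint_of_ne (by simpa using hw),
    Projectivization.mk_eq_mk_iff'] at h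
  obtain ⟨c, hc⟩ := h
  exact ⟨c, e.injective (by simpa using hc)⟩

theorem exists_rep_framePoint (e : (Fin 3 → ℂ) ≃ₗ[ℂ] (Fin 3 → ℂ)) (hv : v ≠ 0) :
    ∃ c : ℂ, c ≠ 0 ∧ (framePoint e v).rep = c • e v := by
  have h : e v ≠ 0 := by simpa using hv
  obtain ⟨a, ha⟩ := Projectivization.exists_smul_eq_mk_rep ℂ (e v) h
  exact ⟨a, a.ne_zero, by rw [framePoint_of_ne h, ← ha]; rfl⟩

theorem isLineSection_framePoint (he : ∀ v, eval (e v) F = hesse l v) (hu : u ≠ 0) (hv : v ≠ 0)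
    (hw : w ≠ 0) (h : LineSec (hesse l) u v w) :
    IsLineSection F (framePoint e u) (framePoint e v) (framePoint e w) := by
  rw [framePoint_of_ne (by simpa using hu), framePoint_of_ne (by simpa using hv),
    framePoint_of_ne (by simpa using hw)]
  refine isLineSection_mk _ _ _ (LineSec.map (f := fun v => eval v F) e ?_)
  simpa only [he] using h

theorem polar_frame (hF : F.IsHomogeneous 3) (he : ∀ v, eval (e v) F = hesse l v)
    (v w : Fin 3 → ℂ) : polar F (e v) (e w) = 3 * hesseTangent l v w := by
  have h1 := eval_smul_add_smul hF 1 1 (e v) (e w)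
  have h2 := eval_smul_add_smul hF 1 (-1) (e v) (e w)
  rw [← map_smul, ← map_smul, ← map_add, he, he, he] at h1 h2
  simp only [hesse, Pi.add_apply, Pi.smul_apply, smul_eq_mul] at h1 h2
  rw [hesseTangent]
  linear_combination (h2 - h1) / 2

theorem framePoint_mem_curve_iff (hF : F.IsHomogeneous 3) (he : ∀ v, eval (e v) F = hesse l v)
    (hv : v ≠ 0) : framePoint e v ∈ curve F ↔ hesse l v = 0 := by
  obtain ⟨c, hc, h⟩ := exists_rep_framePoint e hv
  rw [curve, Set.mem_ofPred_eq, h, eval_smul_of_cubic hF, he]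
  simp [hc]

theorem framePoint_mem_tangentLine_iff (hF : F.IsHomogeneous 3)
    (he : ∀ v, eval (e v) F = hesse l v) (hv : v ≠ 0) (hw : w ≠ 0) :
    framePoint e w ∈ tangentLine F (framePoint e v) ↔ hesseTangent l v w = 0 := by
  obtain ⟨c, hc, h⟩ := exists_rep_framePoint e hv
  obtain ⟨d, hd, h'⟩ := exists_rep_framePoint e hw
  change polar F _ _ = 0 ↔ _
  rw [h, h', polar_smul, polar_smul_left hF, polar_frame hF he]
  simp [hc, hd]

/-- A Hesse cubic that is a smooth cubic in some frame is a smooth member of the Hesse pencil. -/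
theorem IsSmoothCubic.hesse_ne (hF : IsSmoothCubic F) (he : ∀ v, eval (e v) F = hesse l v) :
    l ^ 3 ≠ 1 := by
  intro hl
  have hz : e ![1, l, l] = 0 := by
    refine hF.eq_zero fun w => ?_
    obtain ⟨w, rfl⟩ := e.surjective w
    rw [polar_frame hF.1 he]
    simp [hesseTangent]
    linear_combination (-w 0) * hl
  have := congrFun ((LinearEquiv.map_eq_zero_iff e).1 hz) 0
  simp at this

/-- A flex of a Hesse cubic lies on one of the coordinate lines. -/
theorem mul_eq_zero_of_isFlex (hF : IsSmoothCubic F) (he : ∀ v, eval (e v) F = hesse l v)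
    (hv : v ≠ 0) (h : IsFlex F (framePoint e v)) :
    v 0 * v 1 * v 2 = 0 := by
  have hc := (framePoint_mem_curve_iff hF.1 he hv).1 (IsLineSection.left_mem h)
  obtain ⟨c, hc0, hrep⟩ := exists_rep_framePoint e hv
  have h : LineSec (fun v => eval v F) (e v) (e v) (e v) := by
    have h := LineSec.smul (isLineSection_iff.1 h) (inv_ne_zero hc0) (inv_ne_zero hc0)
      (inv_ne_zero hc0)
    rwa [hrep, inv_smul_smul₀ hc0] at h
  have hev : e v ≠ 0 := by simpa using hv
  -- The tangent direction in the plane `x = 0`, on which the second polar must vanish.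
  have key := h.polar_eq_zero_of_flex hF hev
    (w' := e ![0, v 2 ^ 2 - l * v 0 * v 1, -(v 1 ^ 2 - l * v 0 * v 2)])
    (by rw [polar_frame hF.1 he]; simp [hesseTangent]; ring)
  rw [polar_frame hF.1 he] at key
  simp [hesseTangent] at key
  rw [hesse] at hc
  have h1 : (l ^ 3 - 1) * (v 0 ^ 3 * v 1 * v 2) = 0 := by
    linear_combination key - v 1 * v 2 * hc
  have h2 := (mul_eq_zero.1 h1).resolve_left (sub_ne_zero.2 (hF.hesse_ne he))
  have h3 : (v 0 * v 1 * v 2) ^ 3 = 0 := by linear_combination v 1 ^ 2 * v 2 ^ 2 * h2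
  exact pow_eq_zero_iff (by norm_num) |>.1 h3

end

/-! ### Torsion in Hesse coordinates -/

theorem add_origin {F : MvPolynomial (Fin 3) ℂ} {O P : Plane} (hF : IsSmoothCubic F)
    (hO : O ∈ curve F) (hP : P ∈ curve F) : add F O P O = P :=
  (isLineSection_third hF hP hO).swap_left.swap_right.third_eq hF

theorem IsLineSection.congr {F : MvPolynomial (Fin 3) ℂ} {P P' Q Q' R R' : Plane}
    (h : IsLineSection F P Q R) (hP : P' = P) (hQ : Q' = Q) (hR : R' = R) :
    IsLineSection F P' Q' R' := by
  rwa [hP, hQ, hR]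

theorem eq_or_eq_or_eq_of_cube_eq_one {ω ε : ℂ} (hω : ω ^ 2 + ω + 1 = 0) (hε : ε ^ 3 = 1) :
    ε = 1 ∨ ε = ω ∨ ε = ω ^ 2 := by
  have h : (ε - 1) * ((ε - ω) * (ε - ω ^ 2)) = 0 := by
    linear_combination hε + (-ε ^ 2 + ε * ω - (ω - 1)) * hω
  rcases mul_eq_zero.1 h with h | h
  · exact Or.inl (sub_eq_zero.1 h)
  rcases mul_eq_zero.1 h with h | h
  · exact Or.inr (Or.inl (sub_eq_zero.1 h))
  · exact Or.inr (Or.inr (sub_eq_zero.1 h))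

section

variable {F : MvPolynomial (Fin 3) ℂ} {e : (Fin 3 → ℂ) ≃ₗ[ℂ] (Fin 3 → ℂ)} {l m ω ε x y z : ℂ}

theorem isLineSection_flex (he : ∀ v, eval (e v) F = hesse l v) (hε : ε ^ 3 = 1)
    (h : x ^ 3 + y ^ 3 + z ^ 3 = 3 * l * x * y * z) (hne : x + ε ^ 2 * y + l * ε * z ≠ 0) :
    IsLineSection F (framePoint e ![1, -ε, 0]) (framePoint e ![x, y, z])
      (framePoint e ![ε * y, x, ε ^ 2 * z]) := by
  have hε0 : ε ≠ 0 := by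
    rintro rfl
    norm_num at hε
  refine isLineSection_framePoint he ?_ ?_ ?_ (lineSec_flex hε h hne)
  · intro h0
    simpa using congrFun h0 0
  · intro h0
    have h1 := congrFun h0 0
    have h2 := congrFun h0 1
    have h3 := congrFun h0 2
    simp at h1 h2 h3
    simp [h1, h2, h3] at hne
  · intro h0
    have h1 := congrFun h0 0
    have h2 := congrFun h0 1
    have h3 := congrFun h0 2
    simp [hε0] at h1 h2 h3
    simp [h1, h2, h3] at hne

theorem isFlex_framePoint (hl : l ^ 3 ≠ 1) (he : ∀ v, eval (e v) F = hesse l v)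
    (hε : ε ^ 3 = 1) : IsFlex F (framePoint e ![1, -ε, 0]) := by
  have h0 : ![1, -ε, 0] ≠ 0 := fun h0 => by simpa using congrFun h0 0
  exact isLineSection_framePoint he h0 h0 h0 (lineSec_flex_self hl hε)

theorem isFlex_framePoint' (hl : l ^ 3 ≠ 1) (he : ∀ v, eval (e v) F = hesse l v) :
    IsFlex F (framePoint e ![0, 1, -1]) := by
  have h0 : ![(0 : ℂ), 1, -1] ≠ 0 := fun h0 => by simpa using congrFun h0 1
  exact isLineSection_framePoint he h0 h0 h0 (lineSec_flex_self' hl)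

theorem mul_two_flex (hF : IsSmoothCubic F) (hω : ω ^ 2 + ω + 1 = 0)
    (he : ∀ v, eval (e v) F = hesse l v) :
    mul F (framePoint e ![1, -1, 0]) 2 (framePoint e ![1, -ω ^ 2, 0])
      = framePoint e ![1, -ω, 0] := by
  have hl := hF.hesse_ne he
  have hω3 : ω ^ 3 = 1 := by linear_combination (ω - 1) * hω
  rw [mul_two_of_isFlex hF (isFlex_framePoint hl he (one_pow 3)).left_mem
    (isFlex_framePoint hl he (by rw [← pow_mul, mul_comm, pow_mul, hω3, one_pow]))]
  have hne : (1 : ℂ) + 1 ^ 2 * -ω ^ 2 + l * 1 * 0 ≠ 0 := by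
    intro h0
    have h1 : ω = -2 := by linear_combination hω + h0
    rw [h1] at hω
    norm_num at hω
  rw [(isLineSection_flex he (one_pow 3)
    (by linear_combination (-ω ^ 3 - 1) * hω3) hne).third_eq hF]
  refine framePoint_of_eq_smul (c := -ω ^ 2) (fun h0 => ?_) ?_
  · have : ω = 0 := by simpa using h0
    simp [this] at hω
  · ext i
    fin_cases i
    · simp
    · simp
      linear_combination -hω3
    · simp

theorem mul_two_flex' (hF : IsSmoothCubic F) (he : ∀ v, eval (e v) F = hesse l v) :
    mul F (framePoint e ![1, -1, 0]) 2 (framePoint e ![0, 1, -1])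
      = framePoint e ![1, 0, -1] := by
  have hl := hF.hesse_ne he
  rw [mul_two_of_isFlex hF (isFlex_framePoint hl he (one_pow 3)).left_mem
    (isFlex_framePoint' hl he)]
  rw [(isLineSection_flex he (one_pow 3) (by norm_num)
    (flexTangent_ne_zero hl (one_pow 3) (by norm_num) (by norm_num))).third_eq hF]
  simp

/-- The nine flexes, grouped by the coordinate that vanishes, are the cosets of the subgroup
generated by `(1 : -ω² : 0)`. -/
theorem generateThreeTorsion_framePoint (hF : IsSmoothCubic F) (hω : ω ^ 2 + ω + 1 = 0)
    (he : ∀ v, eval (e v) F = hesse l v) :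
    GenerateThreeTorsion F (framePoint e ![1, -1, 0]) (framePoint e ![1, -ω ^ 2, 0])
      (framePoint e ![0, 1, -1]) := by
  have hl := hF.hesse_ne he
  have hω3 : ω ^ 3 = 1 := by linear_combination (ω - 1) * hω
  have hω6 : (ω ^ 2) ^ 3 = 1 := by rw [← pow_mul, mul_comm, pow_mul, hω3, one_pow]
  have hO := isFlex_framePoint hl he (one_pow 3)
  have hT₁ := isFlex_framePoint hl he hω6
  have hT₂ := isFlex_framePoint' hl he
  have hmul₁ : ∀ ε : ℂ, ε ^ 3 = 1 → ∃ k,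
      mul F (framePoint e ![1, -1, 0]) k (framePoint e ![1, -ω ^ 2, 0])
        = framePoint e ![1, -ε, 0] := by
    intro ε hε
    rcases eq_or_eq_or_eq_of_cube_eq_one hω hε with rfl | rfl | rfl
    · exact ⟨0, rfl⟩
    · exact ⟨2, mul_two_flex hF hω he⟩
    · exact ⟨1, mul_one_eq hF hO.left_mem hT₁.left_mem⟩
  refine ⟨(mem_torsion_three_iff hF hO).2 hT₁, (mem_torsion_three_iff hF hO).2 hT₂, fun T hT => ?_⟩
  rw [mem_torsion_three_iff hF hO] at hT
  obtain ⟨v, hv, rfl⟩ := exists_framePoint_eq e T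
  have h0 := mul_eq_zero_of_isFlex hF he hv hT
  have h1 := (framePoint_mem_curve_iff hF.1 he hv).1 hT.left_mem
  have h1 : v 0 ^ 3 + v 1 ^ 3 + v 2 ^ 3 = 0 := by
    rw [hesse] at h1
    linear_combination h1 + 3 * l * h0
  have hne : ∀ {i j k : Fin 3}, v i ^ 3 + v j ^ 3 + v k ^ 3 = 0 → v k = 0 →
      (∀ t, t = i ∨ t = j ∨ t = k) → v i ≠ 0 ∧ (-(v j / v i)) ^ 3 = 1 := by
    intro i j k h hk hall
    have hi : v i ≠ 0 := by
      intro hi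
      have hj : v j = 0 := by
        rw [hi, hk] at h
        simpa using h
      apply hv
      ext t
      rcases hall t with rfl | rfl | rfl
      · simpa using hi
      · simpa using hj
      · simpa using hk
    refine ⟨hi, ?_⟩
    rw [hk] at h
    field_simp
    linear_combination -h
  rcases mul_eq_zero.1 h0 with h0 | h2
  · rcases mul_eq_zero.1 h0 with h0 | h0
    · obtain ⟨hi, hε⟩ := hne (i := 1) (j := 2) (k := 0) (by linear_combination h1) h0 (by decide)
      obtain ⟨k, hk⟩ := hmul₁ _ hε
      generalize hε' : -(v 2 / v 1) = ε at *
      refine ⟨k, 1, ?_⟩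
      rw [hk, mul_one_eq hF hO.left_mem hT₂.left_mem, add, (isLineSection_flex he hε (by norm_num)
        (flexTangent_ne_zero hl hε (by norm_num) (by norm_num))).third_eq hF]
      have hε2 : ε ^ 2 * -1 ≠ 0 := by
        have : ε ≠ 0 := by
          rintro rfl
          norm_num at hε
        simpa using this
      rw [(isLineSection_flex he (one_pow 3) (by linear_combination -ε ^ 3 * hε)
        (flexTangent_ne_zero hl (one_pow 3)
          (by linear_combination -ε ^ 3 * hε) hε2)).third_eq hF]
      refine framePoint_of_eq_smul (c := v 1 * ε ^ 2) (by simpa [hi] using hε2) ?_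
      have hv2 : v 2 = -(v 1 * ε) := by
        rw [← hε']
        field_simp
      ext i
      fin_cases i
      · simp [h0]
      · simp
        linear_combination -v 1 * hε
      · simp [hv2]
        linear_combination -v 1 * ε * hε
    · obtain ⟨hi, hδ⟩ := hne (i := 0) (j := 2) (k := 1) (by linear_combination h1) h0 (by decide)
      generalize hδ' : -(v 2 / v 0) = δ at *
      have hε : (δ ^ 2) ^ 3 = 1 := by rw [← pow_mul, mul_comm, pow_mul, hδ, one_pow]
      obtain ⟨k, hk⟩ := hmul₁ _ hε
      refine ⟨k, 2, ?_⟩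
      rw [hk, mul_two_flex' hF he, add, (isLineSection_flex he hε (by norm_num)
        (flexTangent_ne_zero hl hε (by norm_num) (by norm_num))).third_eq hF]
      have hε2 : (δ ^ 2) ^ 2 * -1 ≠ 0 := by
        have : δ ≠ 0 := by
          rintro rfl
          norm_num at hδ
        simpa using this
      have hcurve : (δ ^ 2 * 0) ^ 3 + 1 ^ 3 + ((δ ^ 2) ^ 2 * -1) ^ 3
          = 3 * l * (δ ^ 2 * 0) * 1 * ((δ ^ 2) ^ 2 * -1) := by
        linear_combination -(δ ^ 9 + δ ^ 6 + δ ^ 3 + 1) * hδ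
      rw [(isLineSection_flex he (one_pow 3) hcurve
        (flexTangent_ne_zero hl (one_pow 3) hcurve hε2)).third_eq hF]
      refine framePoint_of_eq_smul (c := v 0) hi ?_
      have hv2 : v 2 = -(v 0 * δ) := by
        rw [← hδ']
        field_simp
      ext i
      fin_cases i
      · simp
      · simp [h0]
      · simp [hv2]
        left
        linear_combination -δ * hδ
  · obtain ⟨hi, hε⟩ := hne (i := 0) (j := 1) (k := 2) (by linear_combination h1) h2 (by decide)
    obtain ⟨k, hk⟩ := hmul₁ _ hε
    refine ⟨k, 0, ?_⟩
    rw [hk, mul, add_origin hF hO.left_mem (isFlex_framePoint hl he hε).left_mem]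
    refine framePoint_of_eq_smul (c := v 0) hi ?_
    ext i
    fin_cases i
    · simp
    · simp
      field_simp
    · simp [h2]

/-- Coordinates of `[n] P` for a point `P = (x : y : z)` with `[3] P = (1 : -ω² : 0)`, when
`(1 : -1 : 0)` is the origin: translation by `[3] P` is the substitution `(x : ω² y : ω z)`, and
`[2] P = (ω y : x : ω² z)` is the negative of the residual point of `P`. -/
def nineMultiple (ω x y z : ℂ) (n : ℕ) : Fin 3 → ℂ :=
  if n % 3 = 0 then ![1, -(ω ^ (n / 3)) ^ 2, 0]
  else if n % 3 = 1 then ![x, (ω ^ (n / 3)) ^ 2 * y, ω ^ (n / 3) * z]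
  else ![ω * y, (ω ^ (n / 3)) ^ 2 * x, ω ^ (n / 3) * ω ^ 2 * z]

theorem nineMultiple_three_mul (ω x y z : ℂ) (k : ℕ) :
    nineMultiple ω x y z (3 * k) = ![1, -(ω ^ k) ^ 2, 0] := by
  simp [nineMultiple]

theorem nineMultiple_three_mul_add_one (ω x y z : ℂ) (k : ℕ) :
    nineMultiple ω x y z (3 * k + 1) = ![x, (ω ^ k) ^ 2 * y, ω ^ k * z] := by
  simp [nineMultiple, Nat.mul_add_div]

theorem nineMultiple_three_mul_add_two (ω x y z : ℂ) (k : ℕ) :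
    nineMultiple ω x y z (3 * k + 2) = ![ω * y, (ω ^ k) ^ 2 * x, ω ^ k * ω ^ 2 * z] := by
  simp [nineMultiple, Nat.mul_add_div]

theorem exists_three_mul (n : ℕ) : ∃ k, n = 3 * k ∨ n = 3 * k + 1 ∨ n = 3 * k + 2 :=
  ⟨n / 3, by omega⟩

theorem isLineSection_nine (he : ∀ v, eval (e v) F = hesse l v) (hω : ω ^ 2 + ω + 1 = 0)
    (hm : m ≠ 0) (hx : x ^ 3 = l + m) (hy : y ^ 3 = l + ω * m) (hz : z ^ 3 = l + ω ^ 2 * m)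
    (hxyz : x * y * z = 1) :
    IsLineSection F (framePoint e ![x, y, z]) (framePoint e ![x, y, z])
      (framePoint e ![x, ω * y, ω ^ 2 * z]) := by
  have hx0 : x ≠ 0 := by
    rintro rfl
    simp at hxyz
  have h0 : ∀ a b, ![x, a, b] ≠ 0 := fun a b h0 => hx0 (by simpa using congrFun h0 0)
  exact isLineSection_framePoint he (h0 _ _) (h0 _ _) (h0 _ _) (lineSec_nine hω hm hx hy hz hxyz)

/-- The multiples of a point of order nine. In the line sections used, negation is the exchange of
the first two coordinates. -/
theorem mul_framePoint (hF : IsSmoothCubic F) (he : ∀ v, eval (e v) F = hesse l v)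
    (hω : ω ^ 2 + ω + 1 = 0) (hm : m ≠ 0) (hx : x ^ 3 = l + m) (hy : y ^ 3 = l + ω * m)
    (hz : z ^ 3 = l + ω ^ 2 * m) (hxyz : x * y * z = 1) (n : ℕ) :
    mul F (framePoint e ![1, -1, 0]) n (framePoint e ![x, y, z])
      = framePoint e (nineMultiple ω x y z n) := by
  have hl := hF.hesse_ne he
  have hω3 : ω ^ 3 = 1 := by linear_combination (ω - 1) * hω
  have hω0 : ω ≠ 0 := by
    rintro rfl
    norm_num at hω
  have hz0 : z ≠ 0 := by
    rintro rfl
    simp at hxyz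
  have hpow : ∀ k : ℕ, (ω ^ k) ^ 3 = 1 := fun k => by
    rw [← pow_mul, mul_comm, pow_mul, hω3, one_pow]
  have hcurve : x ^ 3 + y ^ 3 + z ^ 3 = 3 * l * x * y * z := by
    linear_combination hx + hy + hz + m * hω - 3 * l * hxyz
  have h1 : framePoint e ![x, y, z] = framePoint e (nineMultiple ω x y z 1) := by
    simp [nineMultiple]
  rw [h1]
  refine mul_eq_of_isLineSection hF (fun n => framePoint e (nineMultiple ω x y z n))
    (fun n => framePoint e ![nineMultiple ω x y z n 1, nineMultiple ω x y z n 0,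
      nineMultiple ω x y z n 2]) (by simp [nineMultiple]) (fun n => ?_) (fun n => ?_) n
  · obtain ⟨k, rfl | rfl | rfl⟩ := exists_three_mul n
    · rw [nineMultiple_three_mul]
      have hε := hpow k
      generalize ω ^ k = ε at hε
      by_cases h : ε ^ 2 = 1
      · have hO := isFlex_framePoint hl he (one_pow 3)
        rw [h]
        refine IsLineSection.congr hO rfl (framePoint_of_eq_smul (c := -1) (by simp) ?_) rfl
        ext i
        fin_cases i <;> simp
      · refine (isLineSection_flex he (one_pow 3) (x := -ε ^ 2) (y := 1) (z := 0)
          (by linear_combination (-ε ^ 3 - 1) * hε)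
          (fun h0 => h (by linear_combination -h0))).congr rfl rfl ?_
        simp
    · rw [nineMultiple_three_mul_add_one]
      have hε := hpow k
      generalize ω ^ k = ε at hε
      have hε0 : ε ≠ 0 := by
        rintro rfl
        norm_num at hε
      have hc : (ε ^ 2 * y) ^ 3 + x ^ 3 + (ε * z) ^ 3 = 3 * l * (ε ^ 2 * y) * x * (ε * z) := by
        linear_combination hcurve + (y ^ 3 * (ε ^ 3 + 1) + z ^ 3 - 3 * l * x * y * z) * hε
      refine (isLineSection_flex he (one_pow 3) hc (flexTangent_ne_zero hl (one_pow 3) hc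
        (mul_ne_zero hε0 hz0))).congr rfl rfl ?_
      simp
    · rw [nineMultiple_three_mul_add_two]
      have hε := hpow k
      generalize ω ^ k = ε at hε
      have hε0 : ε ≠ 0 := by
        rintro rfl
        norm_num at hε
      have hc : (ε ^ 2 * x) ^ 3 + (ω * y) ^ 3 + (ε * ω ^ 2 * z) ^ 3
          = 3 * l * (ε ^ 2 * x) * (ω * y) * (ε * ω ^ 2 * z) := by
        linear_combination hcurve + (x ^ 3 * (ε ^ 3 + 1) + z ^ 3 - 3 * l * x * y * z) * hε
          + (y ^ 3 + ε ^ 3 * z ^ 3 * (ω ^ 3 + 1) - 3 * l * x * y * z * ε ^ 3) * hω3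
      refine (isLineSection_flex he (one_pow 3) hc (flexTangent_ne_zero hl (one_pow 3) hc
        (mul_ne_zero (mul_ne_zero hε0 (pow_ne_zero 2 hω0)) hz0))).congr rfl rfl ?_
      simp
  · rw [← h1]
    obtain ⟨k, rfl | rfl | rfl⟩ := exists_three_mul n
    · rw [nineMultiple_three_mul, nineMultiple_three_mul_add_one]
      have hε := hpow k
      generalize ω ^ k = ε at hε
      have hε' : (ε ^ 2) ^ 3 = 1 := by rw [← pow_mul, mul_comm, pow_mul, hε, one_pow]
      refine (isLineSection_flex he hε' hcurve
        (flexTangent_ne_zero hl hε' hcurve hz0)).congr rfl rfl (congrArg _ ?_)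
      ext i
      fin_cases i
      · simp
      · simp
      · simp
        left
        linear_combination -ε * hε
    · rw [nineMultiple_three_mul_add_one, nineMultiple_three_mul_add_two]
      have hε := eq_or_eq_or_eq_of_cube_eq_one hω (hpow k)
      generalize ω ^ k = ε at hε
      rcases hε with rfl | rfl | rfl
      · refine (isLineSection_nine he hω hm hx hy hz hxyz).congr ?_ rfl ?_
        · simp
        · simp
      · have h := isLineSection_nine he hω hm (x := x) (y := ε ^ 2 * y) (z := ε * z) hx
          (by linear_combination hy + y ^ 3 * (ε ^ 3 + 1) * hω3)
          (by linear_combination hz + z ^ 3 * hω3)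
          (by linear_combination hxyz + x * y * z * hω3)
        refine h.swap_right.congr rfl (congrArg _ ?_)
          (framePoint_of_eq_smul (c := ε ^ 2) (pow_ne_zero 2 hω0) ?_)
        · ext i
          fin_cases i
          · simp
          · simp
            linear_combination -y * hω3
          · simp
            linear_combination -z * hω3
        · ext i
          fin_cases i
          · simp
          · simp
            linear_combination -(ε * y) * hω3
          · simp
            ring
      · have h := isLineSection_nine he hω hm hx hy hz hxyz
        refine h.swap_right.swap_left.congr (congrArg _ ?_) rfl
          (framePoint_of_eq_smul (c := ω) hω0 ?_)
        · ext i
          fin_cases i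
          · simp
          · simp
            left
            linear_combination ω * hω3
          · simp
        · ext i
          fin_cases i
          · simp
            left
            linear_combination ω * hω3
          · simp
          · simp
            left
            linear_combination ω * hω3
    · rw [nineMultiple_three_mul_add_two, show 3 * k + 2 + 1 = 3 * (k + 1) by ring,
        nineMultiple_three_mul, pow_succ ω k]
      have hε := hpow k
      generalize ω ^ k = ε at hε
      have hεω : (ε * ω) ^ 3 = 1 := by rw [mul_pow, hε, hω3, one_mul]
      have h := isLineSection_flex he hεω hcurve (flexTangent_ne_zero hl hεω hcurve hz0)
      have hε0 : ε ≠ 0 := by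
        rintro rfl
        norm_num at hε
      refine h.swap_left.swap_right.swap_left.congr
        (framePoint_of_eq_smul (c := ε ^ 2) (pow_ne_zero 2 hε0) ?_) rfl
        (framePoint_of_eq_smul (c := -(ε * ω) ^ 2)
          (neg_ne_zero.2 (pow_ne_zero 2 (mul_ne_zero hε0 hω0))) ?_)
      · ext i
        fin_cases i
        · simp
          linear_combination -(ω * y) * hε
        · simp
        · simp
          linear_combination -(ε * ω ^ 2 * z) * hε
      · ext i
        fin_cases i
        · simp
        · simp
          linear_combination -hεω
        · simp

/-- A point of order nine in Hesse coordinates. -/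
theorem hasOrder_nine_framePoint (hF : IsSmoothCubic F) (he : ∀ v, eval (e v) F = hesse l v)
    (hω : ω ^ 2 + ω + 1 = 0) (hm : m ≠ 0) (hx : x ^ 3 = l + m) (hy : y ^ 3 = l + ω * m)
    (hz : z ^ 3 = l + ω ^ 2 * m) (hxyz : x * y * z = 1) :
    HasOrder F (framePoint e ![1, -1, 0]) (framePoint e ![x, y, z]) 9 := by
  have hω3 : ω ^ 3 = 1 := by linear_combination (ω - 1) * hω
  have hω0 : ω ≠ 0 := by
    rintro rfl
    norm_num at hω
  have hω1 : ω ≠ 1 := by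
    rintro rfl
    norm_num at hω
  have hx0 : x ≠ 0 := by
    rintro rfl
    simp at hxyz
  have hy0 : y ≠ 0 := by
    rintro rfl
    simp at hxyz
  have hz0 : z ≠ 0 := by
    rintro rfl
    simp at hxyz
  have hmul := mul_framePoint hF he hω hm hx hy hz hxyz
  refine ⟨⟨(isLineSection_nine he hω hm hx hy hz hxyz).left_mem, ?_⟩, fun n h0 h9 hn => ?_⟩
  · rw [hmul, show (9 : ℕ) = 3 * 3 from rfl, nineMultiple_three_mul, hω3, one_pow]
  · have hn := hn.2
    rw [hmul] at hn
    obtain ⟨k, rfl | rfl | rfl⟩ := exists_three_mul n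
    · rw [nineMultiple_three_mul] at hn
      obtain ⟨c, hc⟩ := exists_smul_eq_of_framePoint_eq
        (fun h0 => by simpa using congrFun h0 0) (fun h0 => by simpa using congrFun h0 0) hn
      have hc0 : c = 1 := by simpa using congrFun hc 0
      have hc1 : c = (ω ^ k) ^ 2 := by simpa using congrFun hc 1
      rw [hc0] at hc1
      have hk : k = 1 ∨ k = 2 := by omega
      rcases hk with rfl | rfl
      · refine hω1 ?_
        linear_combination hω3 + ω * hc1
      · refine hω1 ?_
        linear_combination -hc1 - ω * hω3
    · rw [nineMultiple_three_mul_add_one] at hn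
      obtain ⟨c, hc⟩ := exists_smul_eq_of_framePoint_eq
        (fun h0 => hx0 (by simpa using congrFun h0 0)) (fun h0 => by simpa using congrFun h0 0) hn
      have hc2 := congrFun hc 2
      simp [hω0, hz0] at hc2
    · rw [nineMultiple_three_mul_add_two] at hn
      obtain ⟨c, hc⟩ := exists_smul_eq_of_framePoint_eq
        (fun h0 => hy0 (by simpa [hω0] using congrFun h0 0))
        (fun h0 => by simpa using congrFun h0 0) hn
      have hc2 := congrFun hc 2
      simp [hω0, hz0] at hc2

end

/-! ### Concurrency of the six lines -/

/-- Suppose `l ^ 3 + m ^ 3 = 1`. For a point of order nine with coordinates `x ^ 3 = l + m`,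
`y ^ 3 = l + ω m`, `z = 1 / (x y)`, concurrency of its tangent line with those at the flexes
`(1 : -η² : 0)` and `(0 : 1 : -1)` forces a quadratic equation `γ + β m + α m ^ 2 = 0` with
coefficients in `ℂ[l]`. This is the norm of its left-hand side down to `ℂ[l]`. It is defined over
any ring, so as to make sense of it both as a number and as a polynomial in `l`. -/
def concurrencyNorm {R : Type*} [CommRing R] (η l : R) : R :=
  ((2 - (1 + l * η) ^ 3) * l ^ 2 + 3 * η + 3 * η ^ 2 * l) ^ 3
    + l ^ 3 * (1 + (1 + l * η) ^ 3) ^ 3 * (1 - l ^ 3)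
    - (1 + (1 + l * η) ^ 3) ^ 3 * (1 - l ^ 3) ^ 2
    + 3 * l * (1 + (1 + l * η) ^ 3) ^ 2 * (1 - l ^ 3)
      * ((2 - (1 + l * η) ^ 3) * l ^ 2 + 3 * η + 3 * η ^ 2 * l)

section

variable {l m ω c c' η x y z a b d : ℂ}

/-- The tangent lines at `(1 : -ω² : 0)` and `(1 : -ω : 0)` meet in `(l : l : 1)`. -/
theorem eq_of_flexTangents (hω : ω ^ 2 + ω + 1 = 0)
    (hA : a + ω * b + l * ω ^ 2 * d = 0) (hB : a + ω ^ 2 * b + l * ω * d = 0) :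
    a = l * d ∧ b = l * d := by
  have hω1 : ω ≠ 1 := by
    rintro rfl
    norm_num at hω
  have hω0 : ω ≠ 0 := by
    rintro rfl
    norm_num at hω
  have hb : b = l * d := by
    have h : ω * (ω - 1) * (b - l * d) = 0 := by linear_combination hB - hA
    exact sub_eq_zero.1
      ((mul_eq_zero.1 h).resolve_left (mul_ne_zero hω0 (sub_ne_zero.2 hω1)))
  refine ⟨?_, hb⟩
  rw [hb] at hA
  linear_combination hA - l * d * hω

theorem eq_zero_of_flexTangents (hl : l ^ 3 ≠ 1) (hω : ω ^ 2 + ω + 1 = 0)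
    (hA : a + ω * b + l * ω ^ 2 * d = 0) (hB : a + ω ^ 2 * b + l * ω * d = 0)
    (hC : l * a + b + d = 0) : a = 0 ∧ b = 0 ∧ d = 0 := by
  obtain ⟨rfl, rfl⟩ := eq_of_flexTangents hω hA hB
  have h : (l ^ 3 - 1) * d = 0 := by linear_combination (l - 1) * hC
  have hd := (mul_eq_zero.1 h).resolve_left (sub_ne_zero.2 hl)
  simp [hd]

/-- The tangent lines at `(1 : -ω² : 0)`, `(1 : -ω : 0)` and at a point of order nine are
concurrent only if `9 l ^ 3 = 1`. Concurrency is the vanishing of a sum of three terms, which is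
turned into an equation between their cubes and their product; these are polynomials in `l, m`. -/
theorem eq_zero_of_flexTangents_of_nineTangent (hl : l ^ 3 ≠ 1) (hl' : 9 * l ^ 3 ≠ 1)
    (hω : ω ^ 2 + ω + 1 = 0)
    (hm : l ^ 3 + m ^ 3 = 1) (hx : x ^ 3 = l + m) (hy : y ^ 3 = l + ω * m)
    (hz : z ^ 3 = l + ω ^ 2 * m) (hxyz : x * y * z = 1) (hc : c ^ 3 = 1)
    (hA : a + ω * b + l * ω ^ 2 * d = 0) (hB : a + ω ^ 2 * b + l * ω * d = 0)
    (hD : y * z * a + c * (x * z) * b + c ^ 2 * (x * y) * d = 0) : a = 0 ∧ b = 0 ∧ d = 0 := by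
  obtain ⟨rfl, rfl⟩ := eq_of_flexTangents hω hA hB
  have hω3 : ω ^ 3 = 1 := by linear_combination (ω - 1) * hω
  have hz0 : z ≠ 0 := by
    rintro rfl
    simp at hxyz
  have hd : d = 0 := by
    by_contra hd
    have h1 : l * (y * z) + l * c * (x * z) + c ^ 2 * (x * y) = 0 := by
      refine (mul_eq_zero.1 (?_ : d * _ = 0)).resolve_left hd
      linear_combination hD
    have h2 := cube_add_cube_add_cube h1
    have h3 : l ^ 3 * (y ^ 3 * z ^ 3) + l ^ 3 * c ^ 3 * (x ^ 3 * z ^ 3)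
        + (c ^ 3) ^ 2 * (x ^ 3 * y ^ 3) = 3 * l ^ 2 * c ^ 3 * (x * y * z) ^ 2 := by
      linear_combination h2
    rw [hc, hx, hy, hz, hxyz] at h3
    have h4 : (l ^ 3 - 1) * ((2 * l - ω ^ 2 * m) * (l + ω ^ 2 * m)) = 0 := by
      linear_combination h3 - (l ^ 4 * m + ω ^ 2 * l ^ 3 * m ^ 2 + l * m - ω * (ω - 1) * m ^ 2) * hω
    rcases mul_eq_zero.1 h4 with h | h
    · exact hl (sub_eq_zero.1 h)
    rcases mul_eq_zero.1 h with h | h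
    · have h5 : (2 * l) ^ 3 = m ^ 3 := by
        rw [sub_eq_zero.1 h]
        linear_combination m ^ 3 * (ω ^ 3 + 1) * hω3
      exact hl' (by linear_combination h5 + hm)
    · rw [← hz] at h
      exact hz0 (pow_eq_zero_iff (by norm_num) |>.1 h)
  simp [hd]

/-- The tangent lines at `(1 : -η² : 0)`, `(0 : 1 : -1)` and at a point of order nine are
concurrent only if `concurrencyNorm η l = 0`. -/
theorem eq_zero_of_flexTangent_of_flexTangent_of_nineTangent (hl : l ^ 3 ≠ 1) (hη : η ^ 3 = 1)
    (hN : concurrencyNorm η l ≠ 0)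
    (hω : ω ^ 2 + ω + 1 = 0) (hm : l ^ 3 + m ^ 3 = 1) (hx : x ^ 3 = l + m)
    (hy : y ^ 3 = l + ω * m) (hz : z ^ 3 = l + ω ^ 2 * m) (hxyz : x * y * z = 1) (hc : c ^ 3 = 1)
    (hA : a + η * b + l * η ^ 2 * d = 0) (hC : l * a + b + d = 0)
    (hD : y * z * a + c * (x * z) * b + c ^ 2 * (x * y) * d = 0) : a = 0 ∧ b = 0 ∧ d = 0 := by
  have hω3 : ω ^ 3 = 1 := by linear_combination (ω - 1) * hω
  have hlη : l * η - 1 ≠ 0 := by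
    intro h
    apply hl
    have : (l * η) ^ 3 = 1 := by rw [sub_eq_zero.1 h, one_pow]
    linear_combination this - l ^ 3 * hη
  have hb : b = -(1 + l * η) * d := by
    have h : (l * η - 1) * (b + (1 + l * η) * d) = 0 := by linear_combination l * hA - hC
    have h := (mul_eq_zero.1 h).resolve_left hlη
    linear_combination h
  have ha : a = η * d := by
    rw [hb] at hA
    linear_combination hA
  subst hb ha
  have hd : d = 0 := by
    by_contra hd
    have h1 : η * (y * z) + (-(c * (1 + l * η) * (x * z))) + c ^ 2 * (x * y) = 0 := by
      refine (mul_eq_zero.1 (?_ : d * _ = 0)).resolve_left hd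
      linear_combination hD
    have h2 := cube_add_cube_add_cube h1
    have h3 : η ^ 3 * (y ^ 3 * z ^ 3) - c ^ 3 * (1 + l * η) ^ 3 * (x ^ 3 * z ^ 3)
        + (c ^ 3) ^ 2 * (x ^ 3 * y ^ 3)
        = -3 * η * c ^ 3 * (1 + l * η) * (x * y * z) ^ 2 := by
      linear_combination h2
    rw [hη, hc, hx, hy, hz, hxyz] at h3
    have h4 : ((2 - (1 + l * η) ^ 3) * l ^ 2 + 3 * η + 3 * η ^ 2 * l)
        + ω * l * (1 + (1 + l * η) ^ 3) * m + -(ω ^ 2 * (1 + (1 + l * η) ^ 3) * m ^ 2) = 0 := by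
      linear_combination h3 - (l * m * (1 - (1 + l * η) ^ 3) + ω * m ^ 2) * hω
    -- Taking the norm amounts to applying the same identity to the three terms in `1, m, m ^ 2`.
    have h5 := cube_add_cube_add_cube h4
    apply hN
    rw [concurrencyNorm, show 1 - l ^ 3 = m ^ 3 by linear_combination -hm]
    generalize (2 - (1 + l * η) ^ 3) * l ^ 2 + 3 * η + 3 * η ^ 2 * l = γ at *
    generalize 1 + (1 + l * η) ^ 3 = u at *
    linear_combination h5 - (l ^ 3 * u ^ 3 * m ^ 3 - (ω ^ 3 + 1) * u ^ 3 * m ^ 6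
      + 3 * γ * l * u ^ 2 * m ^ 3) * hω3
  simp [hd]

/-- Two of the three sides of the triangle meet in a point of the curve, a translate of the given
point of order nine by a multiple of the flex `(1 : -ω² : 0)`. -/
theorem exists_vertex_of_nineTangents (hxyz : x * y * z = 1) (hc : c ^ 3 = 1) (hc' : c' ^ 3 = 1)
    (hcc : c ≠ c')
    (hD : y * z * a + c * (x * z) * b + c ^ 2 * (x * y) * d = 0)
    (hD' : y * z * a + c' * (x * z) * b + c' ^ 2 * (x * y) * d = 0) :
    ∃ r, a = r * x ∧ b = r * (c * c' * y) ∧ d = r * ((c * c') ^ 2 * z) := by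
  have h0 : c ^ 2 + c * c' + c' ^ 2 = 0 := by
    refine (mul_eq_zero.1 (?_ : (c - c') * _ = 0)).resolve_left (sub_ne_zero.2 hcc)
    linear_combination hc - hc'
  have h1 : x * z * b + (c + c') * (x * y) * d = 0 := by
    refine (mul_eq_zero.1 (?_ : (c - c') * _ = 0)).resolve_left (sub_ne_zero.2 hcc)
    linear_combination hD - hD'
  refine ⟨a * (y * z), ?_, ?_, ?_⟩
  · linear_combination -a * hxyz
  · linear_combination -b * hxyz + (y + c ^ 2 * c' * y) * h1 - c * c' * y * hD
      - y * (x * y * d) * (c' ^ 2 * h0 - (c + c') * hc')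
  · linear_combination -d * hxyz - z * (x * y * d) * (c' ^ 3 * hc + hc') - (c * c') ^ 2 * z * hD
      + (c * c') ^ 2 * z * c * h1

end

/-- Only the triples of lines with increasing indices need to be considered. -/
theorem noThreeConcurrent_of_lt {n : ℕ} {L : Fin n → Set Plane}
    (h : ∀ i j k, i < j → j < k → ∀ Q, Q ∈ L i → Q ∈ L j → Q ∈ L k → False) :
    NoThreeConcurrent L := by
  intro i j k hij hik hjk
  refine Set.eq_empty_iff_forall_notMem.2 fun Q ⟨⟨hi, hj⟩, hk⟩ => ?_
  rcases lt_or_gt_of_ne hij with h1 | h1 <;> rcases lt_or_gt_of_ne hik with h2 | h2 <;>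
    rcases lt_or_gt_of_ne hjk with h3 | h3
  · exact h _ _ _ h1 h3 Q hi hj hk
  · exact h _ _ _ h2 h3 Q hi hk hj
  · exact absurd (h1.trans h3) h2.not_gt
  · exact h _ _ _ h2 h1 Q hk hi hj
  · exact h _ _ _ h1 h2 Q hj hi hk
  · exact absurd (h3.trans h1) h2.not_gt
  · exact h _ _ _ h3 h2 Q hj hk hi
  · exact h _ _ _ h3 h1 Q hk hj hi

/-- The equation of a side of the triangle through the point of order nine with coordinates
`x, y, z`, where `x * y * z = 1`; the three sides correspond to the cube roots of unity `c`. -/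
def nineTangent (x y z c : ℂ) (w : Fin 3 → ℂ) : ℂ :=
  y * z * w 0 + c * (x * z) * w 1 + c ^ 2 * (x * y) * w 2

/-- The equations of the six lines in Hesse coordinates. -/
def sixForms (l ω x y z : ℂ) (w : Fin 3 → ℂ) : Fin 6 → ℂ :=
  ![w 0 + ω * w 1 + l * ω ^ 2 * w 2, w 0 + ω ^ 2 * w 1 + l * ω * w 2, l * w 0 + w 1 + w 2,
    nineTangent x y z ω w, nineTangent x y z 1 w, nineTangent x y z (ω ^ 2) w]

section

variable {l m ω x y z : ℂ}

theorem eq_zero_of_sixForms_eq_zero (hl : l ^ 3 ≠ 1) (hl' : 9 * l ^ 3 ≠ 1)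
    (hω : ω ^ 2 + ω + 1 = 0) (hN : concurrencyNorm ω l ≠ 0) (hN' : concurrencyNorm (ω ^ 2) l ≠ 0)
    (hm : l ^ 3 + m ^ 3 = 1) (hx : x ^ 3 = l + m) (hy : y ^ 3 = l + ω * m)
    (hz : z ^ 3 = l + ω ^ 2 * m) (hxyz : x * y * z = 1) {w : Fin 3 → ℂ} (i j k : Fin 6)
    (hij : i < j) (hjk : j < k) (hi : sixForms l ω x y z w i = 0)
    (hj : sixForms l ω x y z w j = 0) (hk : sixForms l ω x y z w k = 0) : w = 0 := by
  have hω3 : ω ^ 3 = 1 := by linear_combination (ω - 1) * hω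
  have hω6 : (ω ^ 2) ^ 3 = 1 := by linear_combination (ω ^ 3 + 1) * hω3
  have hω1 : ω ≠ 1 := by
    rintro rfl
    norm_num at hω
  have hω2 : ω ^ 2 ≠ 1 := fun h => hω1 (by linear_combination hω3 - ω * h)
  have hωω : ω ≠ ω ^ 2 := fun h => hω1 (by linear_combination -ω ^ 2 * h - (ω - 1) * hω3)
  have hx0 : x ≠ 0 := by
    rintro rfl
    simp at hxyz
  have hz0 : z ≠ 0 := by
    rintro rfl
    simp at hxyz
  have hw : w 0 = 0 ∧ w 1 = 0 ∧ w 2 = 0 → w = 0 := by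
    rintro ⟨h0, h1, h2⟩
    ext t
    fin_cases t
    · exact h0
    · exact h1
    · exact h2
  have hcurve : ∀ κ : ℂ, κ ^ 3 = 1 → x ^ 3 + (κ * y) ^ 3 + (κ ^ 2 * z) ^ 3
      = 3 * l * x * (κ * y) * (κ ^ 2 * z) := by
    intro κ hκ
    linear_combination hx + hy + hz + m * hω - 3 * l * hxyz
      + (y ^ 3 + z ^ 3 * (κ ^ 3 + 1) - 3 * l * x * y * z) * hκ
  have hABD : ∀ c : ℂ, c ^ 3 = 1 → w 0 + ω * w 1 + l * ω ^ 2 * w 2 = 0 →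
      w 0 + ω ^ 2 * w 1 + l * ω * w 2 = 0 → nineTangent x y z c w = 0 → w = 0 :=
    fun c hc hA hB hD =>
      hw (eq_zero_of_flexTangents_of_nineTangent hl hl' hω hm hx hy hz hxyz hc hA hB hD)
  have hACD : ∀ c : ℂ, c ^ 3 = 1 → w 0 + ω * w 1 + l * ω ^ 2 * w 2 = 0 →
      l * w 0 + w 1 + w 2 = 0 → nineTangent x y z c w = 0 → w = 0 :=
    fun c hc hA hC hD =>
      hw (eq_zero_of_flexTangent_of_flexTangent_of_nineTangent hl hω3 hN hω hm hx hy hz hxyz hc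
        hA hC hD)
  have hBCD : ∀ c : ℂ, c ^ 3 = 1 → w 0 + ω ^ 2 * w 1 + l * ω * w 2 = 0 →
      l * w 0 + w 1 + w 2 = 0 → nineTangent x y z c w = 0 → w = 0 :=
    fun c hc hB hC hD =>
      hw (eq_zero_of_flexTangent_of_flexTangent_of_nineTangent hl hω6 hN' hω hm hx hy hz hxyz hc
        (by linear_combination hB + l * ω * w 2 * hω3) hC hD)
  have hvertex : ∀ c c' : ℂ, c ^ 3 = 1 → c' ^ 3 = 1 → c ≠ c' → nineTangent x y z c w = 0 →
      nineTangent x y z c' w = 0 → ∃ κ r, κ = c * c' ∧ κ ^ 3 = 1 ∧ w 0 = r * x ∧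
        w 1 = r * (κ * y) ∧ w 2 = r * (κ ^ 2 * z) := by
    intro c c' hc hc' hcc hD hD'
    obtain ⟨r, h⟩ := exists_vertex_of_nineTangents hxyz hc hc' hcc hD hD'
    exact ⟨c * c', r, rfl, by rw [mul_pow, hc, hc', one_mul], h⟩
  have hADD : ∀ c c' : ℂ, c ^ 3 = 1 → c' ^ 3 = 1 → c ≠ c' →
      w 0 + ω * w 1 + l * ω ^ 2 * w 2 = 0 → nineTangent x y z c w = 0 →
      nineTangent x y z c' w = 0 → w = 0 := by
    intro c c' hc hc' hcc hA hD hD'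
    obtain ⟨κ, r, -, hκ, h0, h1, h2⟩ := hvertex c c' hc hc' hcc hD hD'
    have h3 : r * (x + (ω ^ 2) ^ 2 * (κ * y) + l * ω ^ 2 * (κ ^ 2 * z)) = 0 := by
      rw [h0, h1, h2] at hA
      linear_combination hA + r * κ * y * ω * hω3
    have hr := (mul_eq_zero.1 h3).resolve_right
      (flexTangent_ne_zero hl hω6 (hcurve κ hκ) (by
        refine mul_ne_zero (pow_ne_zero 2 ?_) hz0
        rintro rfl
        norm_num at hκ))
    exact hw (by simp [h0, h1, h2, hr])
  have hBDD : ∀ c c' : ℂ, c ^ 3 = 1 → c' ^ 3 = 1 → c ≠ c' →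
      w 0 + ω ^ 2 * w 1 + l * ω * w 2 = 0 → nineTangent x y z c w = 0 →
      nineTangent x y z c' w = 0 → w = 0 := by
    intro c c' hc hc' hcc hA hD hD'
    obtain ⟨κ, r, -, hκ, h0, h1, h2⟩ := hvertex c c' hc hc' hcc hD hD'
    have h3 : r * (x + ω ^ 2 * (κ * y) + l * ω * (κ ^ 2 * z)) = 0 := by
      rw [h0, h1, h2] at hA
      linear_combination hA
    have hr := (mul_eq_zero.1 h3).resolve_right
      (flexTangent_ne_zero hl hω3 (hcurve κ hκ) (by
        refine mul_ne_zero (pow_ne_zero 2 ?_) hz0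
        rintro rfl
        norm_num at hκ))
    exact hw (by simp [h0, h1, h2, hr])
  have hCDD : ∀ c c' : ℂ, c ^ 3 = 1 → c' ^ 3 = 1 → c ≠ c' →
      l * w 0 + w 1 + w 2 = 0 → nineTangent x y z c w = 0 →
      nineTangent x y z c' w = 0 → w = 0 := by
    intro c c' hc hc' hcc hA hD hD'
    obtain ⟨κ, r, -, hκ, h0, h1, h2⟩ := hvertex c c' hc hc' hcc hD hD'
    have h3 : r * (κ * y + 1 ^ 2 * (κ ^ 2 * z) + l * 1 * x) = 0 := by
      rw [h0, h1, h2] at hA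
      linear_combination hA
    have hr := (mul_eq_zero.1 h3).resolve_right
      (flexTangent_ne_zero hl (one_pow 3) (by linear_combination hcurve κ hκ) hx0)
    exact hw (by simp [h0, h1, h2, hr])
  have hDDD : nineTangent x y z ω w = 0 → nineTangent x y z 1 w = 0 →
      nineTangent x y z (ω ^ 2) w = 0 → w = 0 := by
    intro h3 h4 h5
    obtain ⟨κ, r, rfl, hκ, h0, h1, h2⟩ := hvertex ω 1 hω3 (one_pow 3) hω1 h3 h4
    rw [nineTangent, h0, h1, h2] at h5
    have hr : r = 0 := by
      linear_combination h5 / 3 - r * hxyz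
        - r * x * y * z * (1 + (ω ^ 3 + 1)) / 3 * hω3
    exact hw (by simp [h0, h1, h2, hr])
  have h1 : (1 : ℂ) ^ 3 = 1 := one_pow 3
  have hcases : ∀ i j k : Fin 6, i < j → j < k → (i, j, k) ∈
      [(0, 1, 2), (0, 1, 3), (0, 1, 4), (0, 1, 5), (0, 2, 3), (0, 2, 4), (0, 2, 5),
        (0, 3, 4), (0, 3, 5), (0, 4, 5), (1, 2, 3), (1, 2, 4), (1, 2, 5), (1, 3, 4),
        (1, 3, 5), (1, 4, 5), (2, 3, 4), (2, 3, 5), (2, 4, 5), (3, 4, 5)] := by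
    decide
  have hcases := hcases i j k hij hjk
  simp only [List.mem_cons, Prod.mk.injEq, List.not_mem_nil, or_false] at hcases
  rcases hcases with
    ⟨rfl, rfl, rfl⟩ | ⟨rfl, rfl, rfl⟩ | ⟨rfl, rfl, rfl⟩ | ⟨rfl, rfl, rfl⟩ | ⟨rfl, rfl, rfl⟩ |
    ⟨rfl, rfl, rfl⟩ | ⟨rfl, rfl, rfl⟩ | ⟨rfl, rfl, rfl⟩ | ⟨rfl, rfl, rfl⟩ | ⟨rfl, rfl, rfl⟩ |
    ⟨rfl, rfl, rfl⟩ | ⟨rfl, rfl, rfl⟩ | ⟨rfl, rfl, rfl⟩ | ⟨rfl, rfl, rfl⟩ | ⟨rfl, rfl, rfl⟩ |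
    ⟨rfl, rfl, rfl⟩ | ⟨rfl, rfl, rfl⟩ | ⟨rfl, rfl, rfl⟩ | ⟨rfl, rfl, rfl⟩ | ⟨rfl, rfl, rfl⟩
  · exact hw (eq_zero_of_flexTangents hl hω hi hj hk)
  · exact hABD _ hω3 hi hj hk
  · exact hABD _ h1 hi hj hk
  · exact hABD _ hω6 hi hj hk
  · exact hACD _ hω3 hi hj hk
  · exact hACD _ h1 hi hj hk
  · exact hACD _ hω6 hi hj hk
  · exact hADD _ _ hω3 h1 hω1 hi hj hk
  · exact hADD _ _ hω3 hω6 hωω hi hj hk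
  · exact hADD _ _ h1 hω6 hω2.symm hi hj hk
  · exact hBCD _ hω3 hi hj hk
  · exact hBCD _ h1 hi hj hk
  · exact hBCD _ hω6 hi hj hk
  · exact hBDD _ _ hω3 h1 hω1 hi hj hk
  · exact hBDD _ _ hω3 hω6 hωω hi hj hk
  · exact hBDD _ _ h1 hω6 hω2.symm hi hj hk
  · exact hCDD _ _ hω3 h1 hω1 hi hj hk
  · exact hCDD _ _ hω3 hω6 hωω hi hj hk
  · exact hCDD _ _ h1 hω6 hω2.symm hi hj hk
  · exact hDDD hi hj hk

/-- Since `x (x ^ 2 - l y z) = m` and `x * y * z = 1`, the first coefficient of the tangent line at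
`(x : y : z)` is `m y z`, and similarly for the others. -/
theorem hesseTangent_nine (hx : x ^ 3 = l + m) (hy : y ^ 3 = l + ω * m)
    (hz : z ^ 3 = l + ω ^ 2 * m) (hxyz : x * y * z = 1) {κ : ℂ} (hκ : κ ^ 3 = 1)
    (w : Fin 3 → ℂ) :
    hesseTangent l ![x, κ * y, κ ^ 2 * z] w = m * nineTangent x y z (ω * κ ^ 2) w := by
  have h0 : x ^ 2 = (l + m) * (y * z) := by linear_combination y * z * hx - x ^ 2 * hxyz
  have h1 : y ^ 2 = (l + ω * m) * (x * z) := by linear_combination x * z * hy - y ^ 2 * hxyz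
  have h2 : z ^ 2 = (l + ω ^ 2 * m) * (x * y) := by linear_combination x * y * hz - z ^ 2 * hxyz
  simp [hesseTangent, nineTangent]
  linear_combination w 0 * h0 + κ ^ 2 * w 1 * h1 + κ ^ 4 * w 2 * h2
    + (-l * y * z * w 0 + l * κ * x * y * w 2) * hκ

variable {F : MvPolynomial (Fin 3) ℂ} {e : (Fin 3 → ℂ) ≃ₗ[ℂ] (Fin 3 → ℂ)}

/-- The conclusion of the theorem for a cubic in Hesse form with general parameter. -/
theorem exists_triangle_of_hesse (hF : IsSmoothCubic F) (he : ∀ v, eval (e v) F = hesse l v)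
    (hω : ω ^ 2 + ω + 1 = 0) (hl' : 9 * l ^ 3 ≠ 1) (hN : concurrencyNorm ω l ≠ 0)
    (hN' : concurrencyNorm (ω ^ 2) l ≠ 0) :
    ∃ (T₁ T₂ : Plane) (L : Fin 3 → Set Plane),
      GenerateThreeTorsion F (framePoint e ![1, -1, 0]) T₁ T₂ ∧
      IsTriangleAssociatedTo F (framePoint e ![1, -1, 0]) T₁ L ∧
      NoThreeConcurrent
        ![tangentLine F T₁, tangentLine F (mul F (framePoint e ![1, -1, 0]) 2 T₁),
          tangentLine F T₂, L 0, L 1, L 2] := by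
  have hl := hF.hesse_ne he
  have hω3 : ω ^ 3 = 1 := by linear_combination (ω - 1) * hω
  obtain ⟨m, hm⟩ := IsAlgClosed.exists_pow_nat_eq (1 - l ^ 3) (n := 3) (by norm_num)
  have hm0 : m ≠ 0 := by
    rintro rfl
    exact hl (by linear_combination hm)
  obtain ⟨x, hx⟩ := IsAlgClosed.exists_pow_nat_eq (l + m) (n := 3) (by norm_num)
  obtain ⟨y, hy⟩ := IsAlgClosed.exists_pow_nat_eq (l + ω * m) (n := 3) (by norm_num)
  have hnorm : (l + m) * (l + ω * m) * (l + ω ^ 2 * m) = 1 := by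
    linear_combination hm + (l ^ 2 * m + l * m ^ 2 * ω + m ^ 3 * (ω - 1)) * hω
  have hx0 : x ≠ 0 := by
    rintro rfl
    rw [← hx] at hnorm
    norm_num at hnorm
  have hy0 : y ≠ 0 := by
    rintro rfl
    rw [← hy] at hnorm
    norm_num at hnorm
  obtain ⟨z, hxyz⟩ : ∃ z, x * y * z = 1 := ⟨(x * y)⁻¹, by field_simp⟩
  have hz : z ^ 3 = l + ω ^ 2 * m := by
    have h1 : x ^ 3 * y ^ 3 * z ^ 3 = 1 := by rw [← mul_pow, ← mul_pow, hxyz, one_pow]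
    have h2 : x ^ 3 * y ^ 3 * (z ^ 3 - (l + ω ^ 2 * m)) = 0 := by
      rw [mul_sub, h1, hx, hy, hnorm, sub_self]
    exact sub_eq_zero.1 ((mul_eq_zero.1 h2).resolve_left (by positivity))
  have hP := isLineSection_nine he hω hm0 hx hy hz hxyz
  have hP' := isLineSection_nine he hω hm0 (x := x) (y := ω * y) (z := ω ^ 2 * z) hx
    (by linear_combination hy + y ^ 3 * hω3)
    (by linear_combination hz + z ^ 3 * (ω ^ 3 + 1) * hω3)
    (by linear_combination hxyz + x * y * z * hω3)
  have hr : residual F (framePoint e ![x, y, z]) = framePoint e ![x, ω * y, ω ^ 2 * z] :=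
    hP.third_eq hF
  have hr' : residual F (framePoint e ![x, ω * y, ω ^ 2 * z])
      = framePoint e ![x, ω ^ 2 * y, (ω ^ 2) ^ 2 * z] := by
    rw [residual, hP'.third_eq hF]
    congr 3
    · ring
    · ring_nf
  refine ⟨framePoint e ![1, -ω ^ 2, 0], framePoint e ![0, 1, -1],
    ![tangentLine F (framePoint e ![x, y, z]),
      tangentLine F (framePoint e ![x, ω * y, ω ^ 2 * z]),
      tangentLine F (framePoint e ![x, ω ^ 2 * y, (ω ^ 2) ^ 2 * z])],
    generateThreeTorsion_framePoint hF hω he,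
    ⟨framePoint e ![x, y, z], hasOrder_nine_framePoint hF he hω hm0 hx hy hz hxyz, ?_, rfl,
      by rw [hr]; rfl, by rw [hr, hr']; rfl⟩, ?_⟩
  · rw [mul_framePoint hF he hω hm0 hx hy hz hxyz, show (3 : ℕ) = 3 * 1 from rfl,
      nineMultiple_three_mul, pow_one]
  · rw [mul_two_flex hF hω he]
    have h0 : ∀ a b, ![x, a, b] ≠ 0 := fun a b h0 => hx0 (by simpa using congrFun h0 0)
    have h1 : ∀ a b, ![(1 : ℂ), a, b] ≠ 0 := fun a b h0 => by simpa using congrFun h0 0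
    have h2 : ![(0 : ℂ), 1, -1] ≠ 0 := fun h0 => by simpa using congrFun h0 1
    refine noThreeConcurrent_of_lt fun i j k hij hjk Q hi hj hk => ?_
    obtain ⟨w, hw, rfl⟩ := exists_framePoint_eq e Q
    have hmem : ∀ i, framePoint e w ∈
        (![tangentLine F (framePoint e ![1, -ω ^ 2, 0]), tangentLine F (framePoint e ![1, -ω, 0]),
          tangentLine F (framePoint e ![0, 1, -1]),
          tangentLine F (framePoint e ![x, y, z]),
          tangentLine F (framePoint e ![x, ω * y, ω ^ 2 * z]),
          tangentLine F (framePoint e ![x, ω ^ 2 * y, (ω ^ 2) ^ 2 * z])] : Fin 6 → Set Plane) i →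
        sixForms l ω x y z w i = 0 := by
      intro i h
      have hmem := fun {v} (hv : v ≠ 0) =>
        (framePoint_mem_tangentLine_iff (v := v) hF.1 he hv hw).1
      have hnine : ∀ κ c : ℂ, κ ^ 3 = 1 → c = ω * κ ^ 2 →
          framePoint e w ∈ tangentLine F (framePoint e ![x, κ * y, κ ^ 2 * z]) →
          nineTangent x y z c w = 0 := by
        rintro κ _ hκ rfl h
        have h := hmem (h0 _ _) h
        rw [hesseTangent_nine hx hy hz hxyz hκ] at h
        exact (mul_eq_zero.1 h).resolve_left hm0
      fin_cases i
      · have h := hmem (h1 _ _) h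
        simp [hesseTangent] at h
        change w 0 + ω * w 1 + l * ω ^ 2 * w 2 = 0
        linear_combination h - ω * w 1 * hω3
      · have h := hmem (h1 _ _) h
        simp [hesseTangent] at h
        change w 0 + ω ^ 2 * w 1 + l * ω * w 2 = 0
        linear_combination h
      · have h := hmem h2 h
        simp [hesseTangent] at h
        change l * w 0 + w 1 + w 2 = 0
        linear_combination h
      · exact hnine 1 ω (one_pow 3) (by ring) (by simpa using h)
      · exact hnine ω 1 hω3 (by linear_combination -hω3) h
      · exact hnine (ω ^ 2) (ω ^ 2) (by linear_combination (ω ^ 3 + 1) * hω3)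
          (by linear_combination -ω ^ 2 * hω3) h
    exact hw (eq_zero_of_sixForms_eq_zero hl hl' hω hN hN' (by linear_combination hm) hx hy hz
      hxyz i j k hij hjk (hmem i hi) (hmem j hj) (hmem k hk))

end

/-! ### Reduction to Hesse form -/

/-- The frame given by three linearly independent vectors. -/
theorem exists_frame {a b c : Fin 3 → ℂ}
    (h : ∀ x y z : ℂ, x • a + y • b + z • c = 0 → x = 0 ∧ y = 0 ∧ z = 0) :
    ∃ e : (Fin 3 → ℂ) ≃ₗ[ℂ] (Fin 3 → ℂ), ∀ v, e v = v 0 • a + v 1 • b + v 2 • c := by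
  let φ : (Fin 3 → ℂ) →ₗ[ℂ] (Fin 3 → ℂ) :=
    { toFun := fun v => v 0 • a + v 1 • b + v 2 • c
      map_add' := fun v w => by simp only [Pi.add_apply]; module
      map_smul' := fun t v => by simp only [Pi.smul_apply, smul_eq_mul, RingHom.id_apply]; module }
  have hφ : Function.Injective φ := by
    rw [← LinearMap.ker_eq_bot, LinearMap.ker_eq_bot']
    intro v hv
    obtain ⟨h0, h1, h2⟩ := h _ _ _ hv
    ext i
    fin_cases i
    · exact h0
    · exact h1
    · exact h2
  exact ⟨LinearEquiv.ofInjectiveEndo φ hφ, fun v => rfl⟩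

/-- A cubic polynomial is the sum of the cube and the square of two linear polynomials: a flex
tangent of the curve `y ^ 2 = x ^ 3 + A x ^ 2 + B x + C` is found by solving a quartic equation. -/
theorem exists_cube_add_square (A B C : ℂ) :
    ∃ x m n : ℂ, m ^ 2 = A + 3 * x ∧ 2 * m * n = B + 2 * A * x + 3 * x ^ 2 ∧
      n ^ 2 = C + B * x + A * x ^ 2 + x ^ 3 := by
  obtain ⟨x, hx⟩ : ∃ x : ℂ, 4 * (A + 3 * x) * (C + B * x + A * x ^ 2 + x ^ 3)
      - (B + 2 * A * x + 3 * x ^ 2) ^ 2 = 0 := by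
    let p : Polynomial ℂ := .C 3 * .X ^ 4 + .C (4 * A) * .X ^ 3 + .C (6 * B) * .X ^ 2
      + .C (12 * C) * .X + .C (4 * A * C - B ^ 2)
    have hp : p.degree = 4 := by
      simp only [p]
      compute_degree!
    obtain ⟨x, hx⟩ := IsAlgClosed.exists_root p (by rw [hp]; norm_num)
    refine ⟨x, ?_⟩
    simp only [p, Polynomial.IsRoot, Polynomial.eval_add, Polynomial.eval_mul, Polynomial.eval_C,
      Polynomial.eval_pow, Polynomial.eval_X] at hx
    linear_combination hx
  obtain ⟨m, hm⟩ := IsAlgClosed.exists_pow_nat_eq (A + 3 * x) (n := 2) (by norm_num)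
  by_cases hm0 : m = 0
  · obtain ⟨n, hn⟩ := IsAlgClosed.exists_pow_nat_eq (C + B * x + A * x ^ 2 + x ^ 3) (n := 2)
      (by norm_num)
    refine ⟨x, m, n, hm, ?_, hn⟩
    rw [← hm, hm0] at hx
    have : B + 2 * A * x + 3 * x ^ 2 = 0 := by
      rw [← pow_eq_zero_iff (two_ne_zero)]
      linear_combination -hx
    rw [this, hm0]
    ring
  · refine ⟨x, m, (B + 2 * A * x + 3 * x ^ 2) / (2 * m), hm, by field_simp, ?_⟩
    field_simp
    rw [hm]
    linear_combination -hx

section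

variable {F : MvPolynomial (Fin 3) ℂ} {O : Plane}

/-- A smooth cubic with a flex in Weierstrass form, up to the choice of the origin on the `x`-axis,
with the flex at infinity. -/
theorem exists_weierstrass (hF : IsSmoothCubic F) (hO : IsFlex F O) :
    ∃ (e : (Fin 3 → ℂ) ≃ₗ[ℂ] (Fin 3 → ℂ)) (A B C : ℂ), O.rep = e ![0, 1, 0] ∧
      ∀ v, eval (e v) F = v 1 ^ 2 * v 2
        - (v 0 ^ 3 + A * v 0 ^ 2 * v 2 + B * v 0 * v 2 ^ 2 + C * v 2 ^ 3) := by
  obtain ⟨w, hw, hOw, κ, hκ, e⟩ :=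
    (isLineSection_iff.1 hO).exists_smul_eq_of_tangent hF.1 O.rep_nonzero
  have hO0 : eval O.rep F = 0 := hO.left_mem
  generalize O.rep = o at *
  obtain ⟨hw1, hw2⟩ := LinearIndependent.pair_iff.1 hw (eval w F - κ) (-polar F w o)
    (by rw [sub_smul, e]; module)
  have hk : eval w F ≠ 0 := by rwa [sub_eq_zero.1 hw1]
  have hwo : polar F w o = 0 := neg_eq_zero.1 hw2
  obtain ⟨n, hn⟩ : ∃ n, polar F o n ≠ 0 := by
    by_contra! h
    have h0 := hF.eq_zero h
    exact one_ne_zero (LinearIndependent.pair_iff.1 hw 1 0 (by simp [h0])).1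
  obtain ⟨M, hM⟩ := exists_eval_eq hF.1 w o n
  obtain ⟨ρ, hρ⟩ := IsAlgClosed.exists_pow_nat_eq (-(eval w F)⁻¹) (n := 3) (by norm_num)
  generalize hE : polar F o n = E at *
  generalize polar F n o = p at *
  have hρ0 : ρ ≠ 0 := by
    rintro rfl
    simp [hk] at hρ
  have hρ' : ρ ^ 3 * eval w F = -1 := by
    rw [hρ]
    field_simp
  have hli : ∀ x y z : ℂ, x • w + y • o + z • n = 0 → x = 0 ∧ y = 0 ∧ z = 0 := by
    intro x y z h
    have hz : z = 0 := by
      have h1 : polar F o (x • w + y • o + z • n) = 0 := by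
        rw [h]
        simp [polar]
      rw [polar_add, polar_add, polar_smul, polar_smul, polar_smul, hOw, polar_self hF.1, hO0,
        hE] at h1
      simpa [hn] using h1
    rw [hz] at h
    have := LinearIndependent.pair_iff.1 hw y x (by rw [← h]; module)
    exact ⟨this.2, this.1, hz⟩
  -- Completing the square in `y`, and rescaling `x` by `ρ` and `z` by `E⁻¹`.
  have hvec : ∀ x y z : ℂ, x • (ρ • w - (M * ρ / (2 * E)) • o) + y • o
      + z • (E⁻¹ • n - (p / (2 * E ^ 2)) • o)
      = (ρ * x) • w + (y - M * ρ / (2 * E) * x - p / (2 * E ^ 2) * z) • o + (E⁻¹ * z) • n := by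
    intro x y z
    module
  obtain ⟨e, he⟩ := exists_frame (a := ρ • w - (M * ρ / (2 * E)) • o) (b := o)
    (c := E⁻¹ • n - (p / (2 * E ^ 2)) • o) (by
      intro x y z h
      rw [hvec] at h
      obtain ⟨h0, h1, h2⟩ := hli _ _ _ h
      have h0 : x = 0 := by simpa [hρ0] using h0
      have h2 : z = 0 := by simpa [hn] using h2
      refine ⟨h0, ?_, h2⟩
      simpa [h0, h2] using h1)
  refine ⟨e, -(ρ ^ 2 * E⁻¹ * (polar F w n - M ^ 2 / (4 * E))),
    -(ρ * E⁻¹ ^ 2 * (polar F n w - M * p / (2 * E))),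
    -(E⁻¹ ^ 3 * (eval n F - p ^ 2 / (4 * E))), by simp [he], fun v => ?_⟩
  rw [he, hvec, hM, hO0, hwo, hOw]
  have hE1 : E * E⁻¹ = 1 := mul_inv_cancel₀ hn
  simp only [div_eq_mul_inv, mul_inv, ← inv_pow]
  generalize E⁻¹ = E' at *
  linear_combination v 0 ^ 3 * hρ'
    + v 2 * (v 1 - E' * (M * ρ * v 0 + p * E' * v 2) / 2) ^ 2 * hE1

theorem polar_frame_eq (hF : F.IsHomogeneous 3) (e : (Fin 3 → ℂ) ≃ₗ[ℂ] (Fin 3 → ℂ))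
    (v w : Fin 3 → ℂ) : polar F (e v) (e w)
      = (eval (e (v + w)) F - eval (e (v - w)) F) / 2 - eval (e w) F := by
  have h1 := eval_smul_add_smul hF 1 1 (e v) (e w)
  have h2 := eval_smul_add_smul hF 1 (-1) (e v) (e w)
  rw [one_smul, one_smul, ← map_add] at h1
  rw [one_smul, neg_one_smul, ← sub_eq_add_neg, ← map_sub] at h2
  rw [h1, h2]
  ring

/-- A smooth cubic with two flexes: the flex `O` at infinity, with tangent line `z = 0`, and a flex
with tangent line `y = m u + n z`, where `u` is the first coordinate. The two inequalities say that
the cubic polynomial `u ^ 3 + (m u + n) ^ 2` has no double root. -/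
theorem exists_flex_form (hF : IsSmoothCubic F) (hO : IsFlex F O) :
    ∃ (e : (Fin 3 → ℂ) ≃ₗ[ℂ] (Fin 3 → ℂ)) (m n : ℂ), O.rep = e ![0, 1, 0] ∧
      (∀ v, eval (e v) F = v 1 ^ 2 * v 2 - v 0 ^ 3 - v 2 * (m * v 0 + n * v 2) ^ 2) ∧
      n ≠ 0 ∧ 4 * m ^ 3 ≠ 27 * n := by
  obtain ⟨e, A, B, C, hOe, he⟩ := exists_weierstrass hF hO
  obtain ⟨x, m, n, h1, h2, h3⟩ := exists_cube_add_square A B C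
  obtain ⟨e', he'⟩ := exists_frame (a := e ![1, 0, 0]) (b := e ![0, 1, 0]) (c := e ![x, 0, 1]) (by
    intro a b c h
    rw [← map_smul, ← map_smul, ← map_smul, ← map_add, ← map_add,
      LinearEquiv.map_eq_zero_iff] at h
    have h0 := congrFun h 0
    have h1 := congrFun h 1
    have h2 := congrFun h 2
    simp at h0 h1 h2
    subst h2
    exact ⟨by simpa using h0, h1, rfl⟩)
  have he'' : ∀ v, eval (e' v) F
      = v 1 ^ 2 * v 2 - v 0 ^ 3 - v 2 * (m * v 0 + n * v 2) ^ 2 := by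
    intro v
    rw [he', ← map_smul, ← map_smul, ← map_smul, ← map_add, ← map_add, he]
    simp
    linear_combination v 2 * v 0 ^ 2 * h1 + v 0 * v 2 ^ 2 * h2 + v 2 ^ 3 * h3
  refine ⟨e', m, n, by simp [he', hOe], he'', ?_, ?_⟩
  · rintro rfl
    have : e' ![0, 0, 1] = 0 := by
      refine hF.eq_zero fun w => ?_
      obtain ⟨w, rfl⟩ := e'.surjective w
      rw [polar_frame_eq hF.1, he'', he'', he'']
      simp
      ring
    rw [LinearEquiv.map_eq_zero_iff] at this
    simpa using congrFun this 2
  · intro hmn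
    -- The singular point is the double root of `u ^ 3 + (m u + n) ^ 2`.
    have : e' ![-(4 * m ^ 2 / 9), 0, 1] = 0 := by
      refine hF.eq_zero fun w => ?_
      obtain ⟨w, rfl⟩ := e'.surjective w
      obtain rfl : n = 4 * m ^ 3 / 27 := by linear_combination -hmn / 27
      rw [polar_frame_eq hF.1, he'', he'', he'']
      simp
      ring
    rw [LinearEquiv.map_eq_zero_iff] at this
    simpa using congrFun this 2

/-- Every flex of a smooth cubic becomes `(1 : -1 : 0)` in a suitable Hesse form. -/
theorem exists_hesse (hF : IsSmoothCubic F) (hO : IsFlex F O) :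
    ∃ (e : (Fin 3 → ℂ) ≃ₗ[ℂ] (Fin 3 → ℂ)) (l : ℂ), (∀ v, eval (e v) F = hesse l v) ∧
      O = framePoint e ![1, -1, 0] := by
  obtain ⟨e, m, n, hOe, he, hn, hmn⟩ := exists_flex_form hF hO
  obtain ⟨α, hα⟩ := IsAlgClosed.exists_pow_nat_eq (-1 / (4 * n ^ 2)) (n := 3) (by norm_num)
  have hα0 : α ≠ 0 := by
    rintro rfl
    field_simp at hα
    norm_num at hα
  have hd : 4 * m ^ 3 / (27 * n) - 1 ≠ 0 := by
    intro h
    apply hmn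
    field_simp at h
    linear_combination h
  obtain ⟨δ, hδ⟩ := IsAlgClosed.exists_pow_nat_eq (4 * m ^ 3 / (27 * n) - 1)⁻¹ (n := 3)
    (by norm_num)
  have hδ0 : δ ≠ 0 := by
    intro h
    rw [h] at hδ
    exact inv_ne_zero hd (by rw [← hδ]; norm_num)
  obtain ⟨θ, hθ⟩ := IsAlgClosed.exists_pow_nat_eq (-3 : ℂ) (n := 2) (by norm_num)
  have hθ0 : θ ≠ 0 := by
    rintro rfl
    norm_num at hθ
  obtain ⟨l, hl⟩ : ∃ l, m * δ = -3 * n * α * l := ⟨-m * δ / (3 * n * α), by field_simp⟩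
  have hα' : 4 * n ^ 2 * α ^ 3 = -1 := by
    rw [hα]
    field_simp
  have hδ' : δ ^ 3 = l ^ 3 - 1 := by
    have h1 : δ ^ 3 * (4 * m ^ 3 - 27 * n) = 27 * n := by
      rw [hδ]
      field_simp
    have h2 : (m * δ) ^ 3 = -27 * n ^ 3 * α ^ 3 * l ^ 3 := by rw [hl]; ring
    have h3 : 27 * n * (δ ^ 3 - (l ^ 3 - 1)) = 0 := by
      linear_combination 4 * h2 - h1 - 27 * n * l ^ 3 * hα'
    exact sub_eq_zero.1 ((mul_eq_zero.1 h3).resolve_left (by simpa using hn))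
  -- The flexes `(0 : 1 : 0)` and `(0 : ± n : 1)` lie on the line `u = 0`. Their tangent lines are
  -- to be `p + q + l r = 0` and its conjugates, and the line through them is to be `r = 0`:
  -- this means `u = δ r`, `y = n α θ (p - q)`, `z = α (p + q + l r)`, where `θ = ± (ω - ω²)`.
  obtain ⟨e', he'⟩ := exists_frame (a := e ![0, n * α * θ, α]) (b := e ![0, -(n * α * θ), α])
    (c := e ![δ, 0, α * l]) (by
    intro a b c h
    rw [← map_smul, ← map_smul, ← map_smul, ← map_add, ← map_add,
      LinearEquiv.map_eq_zero_iff] at h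
    have h0 := congrFun h 0
    have h1 := congrFun h 1
    have h2 := congrFun h 2
    simp [hδ0] at h0 h1 h2
    subst h0
    have h1 : (n * α * θ) * (a - b) = 0 := by linear_combination h1
    have h1 := (mul_eq_zero.1 h1).resolve_left (by simp [hn, hα0, hθ0])
    have h2 : α * (a + b) = 0 := by linear_combination h2
    have h2 := (mul_eq_zero.1 h2).resolve_left hα0
    exact ⟨by linear_combination (h1 + h2) / 2, by linear_combination (h2 - h1) / 2, rfl⟩)
  refine ⟨e', l, fun v => ?_, ?_⟩
  · rw [he', ← map_smul, ← map_smul, ← map_smul, ← map_add, ← map_add, he, hesse]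
    simp
    linear_combination
      -(α * (v 0 + v 1 + l * v 2)) * (m * δ * v 2 + n * (α * (v 0 + v 1 + l * v 2))
        + n * α * (v 0 + v 1 - 2 * l * v 2)) * v 2 * hl
      + α * (v 0 + v 1 + l * v 2) * n ^ 2 * α ^ 2 * (v 0 - v 1) ^ 2 * hθ
      - 1 / 4 * (v 0 + v 1 + l * v 2)
        * (3 * (v 0 - v 1) ^ 2 + (v 0 + v 1 - 2 * l * v 2) ^ 2) * hα'
      - v 2 ^ 3 * hδ'
  · have h1 : e' ![1, -1, 0] = (2 * n * α * θ) • O.rep := by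
      rw [he', hOe]
      simp only [← map_smul, ← map_add]
      congr 1
      ext i
      fin_cases i
      · simp
      · simp
        ring
      · simp
    have h0 : e' ![1, -1, 0] ≠ 0 := by
      rw [h1]
      exact smul_ne_zero (by simp [hn, hα0, hθ0]) O.rep_nonzero
    rw [framePoint_of_ne h0, ← O.mk_rep, Projectivization.mk_eq_mk_iff']
    refine ⟨(2 * n * α * θ)⁻¹, ?_⟩
    rw [h1, inv_smul_smul₀ (by simp [hn, hα0, hθ0])]

end

/-! ### Hypersurfaces containing the orbits of single cubics -/

theorem eval_smul_of_isHomogeneous {σ : Type*} {Φ : MvPolynomial σ ℂ} {n : ℕ}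
    (hΦ : Φ.IsHomogeneous n) (s : ℂ) (c : σ → ℂ) : eval (s • c) Φ = s ^ n * eval c Φ := by
  rw [eval_eq, eval_eq, Finset.mul_sum]
  refine Finset.sum_congr rfl fun d hd => ?_
  have h : d.degree = n := by
    rw [Finsupp.degree_eq_weight_one]
    exact hΦ (mem_support_iff.1 hd)
  simp only [Pi.smul_apply, smul_eq_mul, mul_pow, Finset.prod_mul_distrib,
    Finset.prod_pow_eq_pow_sum]
  rw [← Finsupp.degree_apply, h]
  ring

/-- If a polynomial vanishes on the line through the origin and `c`, then so do its homogeneous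
components. -/
theorem eval_homogeneousComponent_eq_zero {σ : Type*} (Φ : MvPolynomial σ ℂ) (c : σ → ℂ)
    (h : ∀ s : ℂ, eval (s • c) Φ = 0) (n : ℕ) : eval c (homogeneousComponent n Φ) = 0 := by
  let p : Polynomial ℂ := ∑ i ∈ Finset.range (Φ.totalDegree + 1),
    .C (eval c (homogeneousComponent i Φ)) * .X ^ i
  have hp : p = 0 := by
    refine Polynomial.funext fun s => ?_
    rw [Polynomial.eval_zero, ← h s]
    conv_rhs => rw [← sum_homogeneousComponent Φ, map_sum]
    simp only [p, Polynomial.eval_finsetSum, Polynomial.eval_mul, Polynomial.eval_C,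
      Polynomial.eval_pow, Polynomial.eval_X]
    refine Finset.sum_congr rfl fun i _ => ?_
    rw [eval_smul_of_isHomogeneous (homogeneousComponent_isHomogeneous i Φ), mul_comm]
  by_cases hn : n ∈ Finset.range (Φ.totalDegree + 1)
  · have := congrArg (fun q => Polynomial.coeff q n) hp
    simpa [p, Polynomial.finsetSum_coeff, Polynomial.coeff_C_mul, Polynomial.coeff_X_pow,
      Finset.sum_ite_eq, hn] using this
  · rw [homogeneousComponent_eq_zero, map_zero]
    simpa using hn

theorem nine_lt_card_cubicExponent : (9 : Cardinal) < Cardinal.mk CubicExponent := by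
  let f : {p : Fin 4 × Fin 4 // p.1.val + p.2.val ≤ 3} → CubicExponent := fun p =>
    ⟨Finsupp.equivFunOnFinite.symm ![p.1.1.val, p.1.2.val, 3 - p.1.1.val - p.1.2.val], by
      have := p.2
      rw [Finsupp.degree_eq_sum]
      simp [Fin.sum_univ_three]
      omega⟩
  have hf : Function.Injective f := by
    intro p q h
    have h := congrArg (fun d : CubicExponent => (d.1 : Fin 3 → ℕ)) h
    have h0 := congrFun h 0
    have h1 := congrFun h 1
    simp [f] at h0 h1
    exact Subtype.ext (Prod.ext (Fin.ext h0) (Fin.ext h1))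
  have h := Cardinal.mk_le_of_injective hf
  rw [Cardinal.mk_fintype, show Fintype.card {p : Fin 4 × Fin 4 // p.1.val + p.2.val ≤ 3} = 10 by
    decide] at h
  refine lt_of_lt_of_le ?_ h
  norm_num

/-- The Hesse cubic composed with the generic linear substitution. -/
noncomputable def genericHesse (l : ℂ) :
    MvPolynomial (Fin 3) (MvPolynomial (Fin 3 × Fin 3) ℂ) :=
  let L : Fin 3 → MvPolynomial (Fin 3) (MvPolynomial (Fin 3 × Fin 3) ℂ) :=
    fun i => ∑ j, C (X (i, j)) * X j
  L 0 ^ 3 + L 1 ^ 3 + L 2 ^ 3 - C (C (3 * l)) * L 0 * L 1 * L 2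

theorem eval_map_genericHesse (l : ℂ) (M : Fin 3 × Fin 3 → ℂ) (v : Fin 3 → ℂ) :
    eval v (map (eval M) (genericHesse l)) = hesse l (fun i => ∑ j, M (i, j) * v j) := by
  simp [genericHesse, hesse]

/-- The cubics projectively equivalent to a given one depend on nine parameters, the entries of a
matrix, hence satisfy an algebraic equation. -/
theorem exists_hypersurface (l : ℂ) :
    ∃ (n : ℕ) (Φ : MvPolynomial CubicExponent ℂ), Φ.IsHomogeneous n ∧ Φ ≠ 0 ∧
      ∀ (F : MvPolynomial (Fin 3) ℂ) (e : (Fin 3 → ℂ) ≃ₗ[ℂ] (Fin 3 → ℂ)),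
        (∀ v, eval (e v) F = hesse l v) → eval (coeffs F) Φ = 0 := by
  let c : CubicExponent → MvPolynomial (Fin 3 × Fin 3) ℂ := fun d => coeff d.1 (genericHesse l)
  have hdep : ¬ AlgebraicIndependent ℂ c := by
    intro h
    have h1 := h.cardinalMk_le_trdeg
    rw [MvPolynomial.trdeg_of_isDomain] at h1
    have h2 := nine_lt_card_cubicExponent
    simp at h1
    exact absurd h1 (not_le.2 h2)
  rw [algebraicIndependent_iff] at hdep
  push Not at hdep
  obtain ⟨Ψ, hΨ, hΨ0⟩ := hdep
  obtain ⟨n, hn⟩ : ∃ n, homogeneousComponent n Ψ ≠ 0 := by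
    by_contra! h
    apply hΨ0
    rw [← sum_homogeneousComponent Ψ]
    exact Finset.sum_eq_zero fun i _ => h i
  refine ⟨n, homogeneousComponent n Ψ, homogeneousComponent_isHomogeneous n Ψ, hn,
    fun F e he => eval_homogeneousComponent_eq_zero _ _ (fun s => ?_) n⟩
  -- Scaling the matrix by `t` scales the coefficients of the cubic by `t ^ 3 = s`.
  obtain ⟨t, rfl⟩ := IsAlgClosed.exists_pow_nat_eq s (n := 3) (by norm_num)
  let M : Fin 3 × Fin 3 → ℂ := fun p => t * e.symm (Pi.single p.2 1) p.1
  have hM : ∀ v : Fin 3 → ℂ, (fun i => ∑ j, M (i, j) * v j) = t • e.symm v := by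
    intro v
    conv_rhs => rw [← Finset.univ_sum_single v]
    ext i
    simp only [map_sum, Pi.smul_apply, Finset.sum_apply, smul_eq_mul, Finset.mul_sum, M]
    refine Finset.sum_congr rfl fun j _ => ?_
    have : (Pi.single j (v j) : Fin 3 → ℂ) = v j • Pi.single j 1 := by
      rw [← Pi.single_smul, smul_eq_mul, mul_one]
    rw [this, map_smul, Pi.smul_apply, smul_eq_mul]
    ring
  have hF : map (eval M) (genericHesse l) = C (t ^ 3) * F := by
    refine MvPolynomial.funext fun v => ?_
    rw [eval_map_genericHesse, hM, map_mul, eval_C, ← e.apply_symm_apply v, he]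
    simp [hesse]
    ring
  have hc : t ^ 3 • coeffs F = fun d => eval M (c d) := by
    ext d
    rw [← coeff_map, hF, coeff_C_mul]
    rfl
  rw [hc]
  have := congrArg (aeval (R := ℂ) M) hΨ
  rw [map_zero, comp_aeval_apply] at this
  exact this

/-! ### Smooth cubics are Zariski dense -/

noncomputable instance : Fintype CubicExponent :=
  (Finsupp.finite_of_degree_eq (σ := Fin 3) 3).fintype

/-- The cubic form with given coefficients. -/
noncomputable def formOf (c : CubicExponent → ℂ) : MvPolynomial (Fin 3) ℂ :=
  ∑ d, C (c d) * monomial d.1 1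

theorem isHomogeneous_formOf (c : CubicExponent → ℂ) : (formOf c).IsHomogeneous 3 := by
  refine IsHomogeneous.sum _ _ _ fun d _ => ?_
  rw [C_mul_monomial]
  exact isHomogeneous_monomial _ d.2

theorem coeffs_formOf (c : CubicExponent → ℂ) : coeffs (formOf c) = c := by
  ext d
  simp [coeffs, formOf, coeff_sum, C_mul_monomial, coeff_monomial, Subtype.coe_inj]

/-- Singular points may be normalized to lie on the unit sphere, which is compact; hence the cubics
that have one form a closed set. -/
theorem isOpen_setOf_isSmoothCubic_formOf : IsOpen {c | IsSmoothCubic (formOf c)} := by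
  let K := Metric.sphere (0 : Fin 3 → ℂ) 1
  let Z : Set (K × (CubicExponent → ℂ)) := {p | eval p.1.1 (formOf p.2) = 0 ∧
    ∀ i, eval p.1.1 (pderiv i (formOf p.2)) = 0}
  have hcont : ∀ P : CubicExponent → MvPolynomial (Fin 3) ℂ,
      Continuous fun p : K × (CubicExponent → ℂ) => ∑ d, p.2 d * eval p.1.1 (P d) := by
    intro P
    refine continuous_finsetSum _ fun d _ => ?_
    have h1 := (MvPolynomial.continuous_eval (P d)).comp
      (continuous_subtype_val.comp (continuous_fst (X := K) (Y := CubicExponent → ℂ)))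
    have h2 := (continuous_apply d).comp (continuous_snd (X := K) (Y := CubicExponent → ℂ))
    exact h2.mul h1
  have hZ : IsClosed Z := by
    refine IsClosed.inter ?_ ?_
    · refine isClosed_eq ?_ continuous_const
      simpa [formOf] using hcont fun d => monomial d.1 1
    · change IsClosed {p : K × (CubicExponent → ℂ) | ∀ i, eval p.1.1 (pderiv i (formOf p.2)) = 0}
      rw [Set.ofPred_forall]
      refine isClosed_iInter fun i => isClosed_eq ?_ continuous_const
      simpa [formOf] using hcont fun d => pderiv i (monomial d.1 1)
  have h := isClosedMap_snd_of_compactSpace Z hZ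
  convert h.isOpen_compl using 1
  ext c
  rw [Set.mem_ofPred_eq, Set.mem_compl_iff]
  constructor
  · rintro hc ⟨⟨⟨v, hv⟩, c'⟩, ⟨h1, h2⟩, rfl⟩
    rw [hc.2 v h1 h2] at hv
    simp [K] at hv
  · intro hc
    refine ⟨isHomogeneous_formOf c, fun v h1 h2 => ?_⟩
    by_contra hv
    have hnorm : (‖v‖ : ℂ) ≠ 0 := by simpa using hv
    refine hc ⟨⟨⟨(‖v‖ : ℂ)⁻¹ • v, ?_⟩, c⟩, ⟨?_, fun i => ?_⟩, rfl⟩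
    · simp [K, norm_smul, hv]
    · change eval ((‖v‖ : ℂ)⁻¹ • v) (formOf c) = 0
      rw [eval_smul_of_isHomogeneous (isHomogeneous_formOf c), h1, mul_zero]
    · change eval ((‖v‖ : ℂ)⁻¹ • v) (pderiv i (formOf c)) = 0
      rw [eval_smul_of_isHomogeneous (isHomogeneous_formOf c).pderiv, h2, mul_zero]

theorem exists_isSmoothCubic_formOf : ∃ c, IsSmoothCubic (formOf c) := by
  let F : MvPolynomial (Fin 3) ℂ := X 0 ^ 3 + X 1 ^ 3 + X 2 ^ 3
  have hF : F.IsHomogeneous 3 :=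
    ((isHomogeneous_X_pow 0 3).add (isHomogeneous_X_pow 1 3)).add (isHomogeneous_X_pow 2 3)
  have hform : formOf (coeffs F) = F := by
    ext d
    by_cases hd : d.degree = 3
    · exact congrFun (coeffs_formOf (coeffs F)) ⟨d, hd⟩
    · rw [(isHomogeneous_formOf _).coeff_eq_zero hd, hF.coeff_eq_zero hd]
  refine ⟨coeffs F, ?_⟩
  rw [hform]
  refine ⟨hF, fun v _ h => ?_⟩
  ext i
  have := h i
  fin_cases i <;> simpa [F, pderiv_X, Pi.single_apply] using this

/-- Every nonzero polynomial in the coefficients is nonzero on some smooth cubic. -/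
theorem exists_isSmoothCubic_eval_ne_zero {Φ : MvPolynomial CubicExponent ℂ} (hΦ : Φ ≠ 0) :
    ∃ F, IsSmoothCubic F ∧ eval (coeffs F) Φ ≠ 0 := by
  by_contra! h
  obtain ⟨c, hc⟩ := exists_isSmoothCubic_formOf
  obtain ⟨ε, hε, hball⟩ := Metric.isOpen_iff.1 isOpen_setOf_isSmoothCubic_formOf c hc
  refine hΦ (MvPolynomial.funext_set (fun d => Metric.ball (c d) ε)
    (fun d => infinite_of_mem_nhds (c d) (Metric.ball_mem_nhds _ hε)) fun x hx => ?_)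
  have hx : x ∈ Metric.ball c ε := by rwa [ball_pi _ hε]
  rw [map_zero, ← h _ (hball hx), coeffs_formOf]

/-! ### The exceptional parameters -/

theorem finite_setOf_concurrencyNorm_eq_zero {η : ℂ} (hη : η ^ 3 = 1) :
    {l : ℂ | concurrencyNorm η l = 0}.Finite := by
  let p : Polynomial ℂ := concurrencyNorm (.C η) .X
  have hp : ∀ l, p.eval l = concurrencyNorm η l := by
    intro l
    simp only [p, concurrencyNorm, Polynomial.eval_add, Polynomial.eval_sub, Polynomial.eval_mul,
      Polynomial.eval_pow, Polynomial.eval_C, Polynomial.eval_X, Polynomial.eval_one,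
      Polynomial.eval_ofNat]
  have hp0 : p ≠ 0 := by
    intro h
    have h0 := hp 0
    rw [h] at h0
    have h1 : concurrencyNorm η 0 = 19 := by
      rw [concurrencyNorm]
      linear_combination 27 * hη
    rw [h1] at h0
    norm_num at h0
  refine (Polynomial.finite_setOfPred_isRoot hp0).subset fun l hl => ?_
  change p.eval l = 0
  rw [hp]
  exact hl

theorem finite_setOf_nine_mul_cube_eq_one : {l : ℂ | 9 * l ^ 3 = 1}.Finite := by
  let p : Polynomial ℂ := .C 9 * .X ^ 3 - 1
  have hp0 : p ≠ 0 := by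
    intro h
    have := congrArg (Polynomial.eval 0) h
    simp [p] at this
  refine (Polynomial.finite_setOfPred_isRoot hp0).subset fun l hl => ?_
  change p.eval l = 0
  have hl : 9 * l ^ 3 = 1 := hl
  simp [p, hl]

end PlaneCubic

theorem proposition3p5 :
    PlaneCubic.HoldsForGeneralSmoothCubic fun F =>
      ∀ O : PlaneCubic.Plane, PlaneCubic.IsFlex F O →
        ∃ (T₁ T₂ : PlaneCubic.Plane) (L : Fin 3 → Set PlaneCubic.Plane),
          PlaneCubic.GenerateThreeTorsion F O T₁ T₂ ∧
          PlaneCubic.IsTriangleAssociatedTo F O T₁ L ∧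
          PlaneCubic.NoThreeConcurrent
            ![PlaneCubic.tangentLine F T₁,
              PlaneCubic.tangentLine F (PlaneCubic.mul F O 2 T₁),
              PlaneCubic.tangentLine F T₂,
              L 0, L 1, L 2] := by
  obtain ⟨ω, hω⟩ : ∃ ω : ℂ, ω ^ 2 + ω + 1 = 0 := by
    obtain ⟨ω, hω⟩ := exists_quadratic_eq_zero (one_ne_zero (α := ℂ)) (b := 1) (c := 1)
      (IsAlgClosed.exists_eq_mul_self _)
    exact ⟨ω, by linear_combination hω⟩
  have hω3 : ω ^ 3 = 1 := by linear_combination (ω - 1) * hω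
  have hω6 : (ω ^ 2) ^ 3 = 1 := by linear_combination (ω ^ 3 + 1) * hω3
  have hfin := (PlaneCubic.finite_setOf_nine_mul_cube_eq_one.union
    (PlaneCubic.finite_setOf_concurrencyNorm_eq_zero hω3)).union
    (PlaneCubic.finite_setOf_concurrencyNorm_eq_zero hω6)
  choose n Φ hhom hΦ0 hΦ using PlaneCubic.exists_hypersurface
  refine ⟨_, ∏ l ∈ hfin.toFinset, Φ l,
    MvPolynomial.IsHomogeneous.prod _ _ n fun l _ => hhom l,
    PlaneCubic.exists_isSmoothCubic_eval_ne_zero (Finset.prod_ne_zero_iff.2 fun l _ => hΦ0 l),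
    fun F hF hgen O hO => ?_⟩
  obtain ⟨e, l, he, rfl⟩ := PlaneCubic.exists_hesse hF hO
  have hl : l ∉ hfin.toFinset := by
    intro hl
    apply hgen
    rw [map_prod]
    exact Finset.prod_eq_zero hl (hΦ l F e he)
  simp only [Set.Finite.mem_toFinset, Set.mem_union, Set.mem_ofPred_eq, not_or] at hl
  exact PlaneCubic.exists_triangle_of_hesse hF he hω hl.1.1 hl.1.2 hl.2
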